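/- **Setting.** Let $(B,\Sigma)$ be the tropicalization of a Looijenga pair $(Y,D)$ with $D=D_1+\dots+D_r$, $r\ge 3$: $B$ is obtained by gluing cyclically, along the rays $\rho_j=\mathbb{R}_{\ge 0}v_j$ ($j\in\mathbb{Z}/r$), the quadrants $\sigma_j$ with edges $\rho_j,\rho_{j+1}$ (in anticlockwise order), with the integral linear structure on $B_0=B\setminus\{0\}$ determined by $v_{j-1}+D_j^2v_j+v_{j+1}=0$ (only the integers $D_j^2$ matter, and they may be arbitrary). Let $\langle-,-\rangle$ be the skew form on integral tangent vectors with $\langle v_j,v_{j+1}\rangle=1$, and $B(\mathbb{Z})$ the set of integral points of $B$, including $0$. Let $k$ be a field of characteristic $0$, $P$ a toric monoid, $J\subset P$ a radical ideal, $\varphi$ a convex multivalued $\Sigma$-piecewise linear function with kinks $\kappa_j\in J$ along $\rho_j$ for all $j$, $I$ an ideal of $P$ of radical $J$, and $R_I=k[P]/I$. For a two-dimensional cone $\sigma$ let $R_{\sigma,I}=R_I[\Lambda_\sigma]$, with monomials $t^\beta z^{\varphi_\sigma(m)}$, with the $R_I$-bilinear Poisson bracket $\{z^{\varphi_\sigma(m)},z^{\varphi_\sigma(m')}\}=\langle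 m,m'\rangle z^{\varphi_\sigma(m+m')}$. Let $\mathfrak{D}$ be a consistent scattering diagram for $(B,\Sigma),P,J,\varphi$ (for example the classical limit of a consistent quantum scattering diagram): a set of rays $\mathfrak{d}$ of rational slope from the origin, with primitive generator $m_{\mathfrak d}$, each with a function $f_{\mathfrak d}$ in the $J$-adic completion of $k[P_{\varphi_\tau}]$ ($\tau$ the smallest cone containing $\mathfrak d$), with constant term $1$ and all other terms of the form $c\,t^\beta z^{\ell\varphi_\tau(m_{\mathfrak d})}$, with all $\ell<0$ (outgoing) or all $\ell>0$ (ingoing), such that $f_{\mathfrak d}\equiv 1$ mod $J$ unless $\mathfrak d$ is some $\rho_j$ with $\kappa_j\in J$, and such that for every ideal $I'$ of radical $J$ only finitely many $f_{\mathfrak d}$ are $\not\equiv 1$ mod $I'$; the supports of those with $f_{\mathfrak d}\not\equiv1$ mod $I$ form $\mathrm{Supp}_I(\mathfrak D)$. Let $f_{\rho_j}$ be the product of the $f_{\mathfrak d}$ with support $\rho_j$ and $$R_{\rho_j,I}=R_I[X_+,X_-,X^{\pm1}]/(X_+X_--t^{\kappa_j}f_{\rho_j}(X)X^{-D_j^2}),$$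 with its restriction maps to $R_{\sigma_{j-1},I}$ and $R_{\sigma_j,I}$ given by $X\mapsto z^{\varphi_{\rho_j}(v_j)}$ together with $X_-\mapsto z^{\varphi_{\rho_j}(v_{j-1})},\ X_+\mapsto f_{\rho_j}(X)z^{\varphi_{\rho_j}(v_{j+1})}$, respectively $X_+\mapsto z^{\varphi_{\rho_j}(v_{j+1})},\ X_-\mapsto f_{\rho_j}(X)z^{\varphi_{\rho_j}(v_{j-1})}$. Let $A_I=\Gamma(X_{I,\mathfrak D}^\circ,\mathcal O)$, where $X^\circ_{I,\mathfrak D}$ is obtained by gluing the $\mathrm{Spec}\,R_{\rho_j,I}$ along the $\mathrm{Spec}\,R_{\sigma_j,I}$ by the wall-crossing automorphisms of $\mathfrak D$ in $\sigma_j$. A broken line $\gamma$ of charge $p\in B_0(\mathbb{Z})$ ending at $z\in B_0$ is a piecewise linear path in $B_0$ with a monomial $c\,t^\beta z^{\varphi(s)}$ attached to each segment, of velocity $-s$ there; it comes from infinity in a cone $\sigma$ containing $p$, with monomial $z^{\varphi_\sigma(p)}$, and each time it crosses a ray, its monomial (of exponent $s$ before the crossing) is multiplied by a nonzero term of the expansion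 of $\left(\prod f_{\mathfrak d}\right)^{|\langle m,s\rangle|}$, the product being over the rays $\mathfrak{d}$ of $\mathfrak D$ with that support, and $m$ the primitive generator of the support. The last monomial is denoted $\mathrm{Mono}(\gamma)=c(\gamma)z^{\varphi_\sigma(s(\gamma))}$ for $z$ in the interior of $\sigma$, with $c(\gamma)$ viewed in $R_I$. Set $\mathrm{Lift}_z(p)=\sum_\gamma \mathrm{Mono}(\gamma)\in R_{\sigma,I}$. Consistency means that for every ideal $I'$ of radical $J$ the $\mathrm{Lift}_z(p)$ modulo $I'$, for $z$ of irrational slope, are compatible with wall crossing inside each cone and, near each $\rho_j$ on both sides, are the restrictions of an element of $R_{\rho_j,I'}$. **Statement.** There is a unique family of theta functions $\vartheta_p\in A_I$, $p\in B(\mathbb{Z})$, with $\vartheta_0=1$ and, for $p\ne0$, with local expressions near each $\rho_j$ equal to $\mathrm{Lift}_z(p)$. There is a unique $R_I$-bilinear bracket $\{-,-\}$ on $A_I$ which restricts to the brackets of all the $R_{\sigma,I}$, and it is a Poisson bracket. For every $p\in B(\mathbb{Z})$ let $z_p$ be a point of irrational slope very close to $p$: it lies in the interior of a two-dimensional cone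 $\sigma$ containing $p$, and the segment from $p$ to $z_p$ does not meet $\mathrm{Supp}_I(\mathfrak{D})$ except possibly at $p$. Then for all $p_1,p_2\in B(\mathbb{Z})$, $$\{\vartheta_{p_1},\vartheta_{p_2}\}=\sum_{p\in B(\mathbb{Z})}P^p_{p_1,p_2}\,\vartheta_p,\qquad P^p_{p_1,p_2}=\sum_{\gamma_1,\gamma_2}\langle s(\gamma_1),s(\gamma_2)\rangle\,c(\gamma_1)c(\gamma_2)\in R_I,$$ where the second sum is over all pairs of broken lines $\gamma_1,\gamma_2$ of charges $p_1,p_2$, both ending at $z_p$, with $s(\gamma_1)+s(\gamma_2)=p$ in $\Lambda_\sigma$ (there are none if $p_1$ or $p_2$ is $0$). For each $p$ only finitely many pairs have $c(\gamma_1)\ne0\ne c(\gamma_2)$ in $R_I$, and only finitely many $P^p_{p_1,p_2}$ are nonzero. -/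

import Mathlib

noncomputable section

namespace LPMirror

open AddMonoidAlgebra

/-! ## Toric monoids and monomial ideals -/

/-- A toric monoid: a finitely generated, integral, saturated commutative monoid whose group
completion is torsion free. -/
class IsToricMonoid (P : Type*) [AddCommMonoid P] : Prop where
  fg : AddMonoid.FG P
  cancel : ∀ a b c : P, a + b = a + c → b = c
  torsionFree : ∀ (n : ℕ) (a b : P), n ≠ 0 → n • a = n • b → a = b
  saturated : ∀ (n : ℕ) (a b c : P), n ≠ 0 → n • a = n • b + c → ∃ d, a = b + d

/-- Ideals of a commutative monoid. -/
def IsMonoidIdeal {P : Type*} [AddCommMonoid P] (I : Set P) : Prop :=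
  ∀ a ∈ I, ∀ b, a + b ∈ I

/-- The radical of an ideal of a commutative monoid. -/
def monoidRadical {P : Type*} [AddCommMonoid P] (I : Set P) : Set P :=
  {a | ∃ n : ℕ, 0 < n ∧ n • a ∈ I}

/-- The ideals `I` of `P` with radical `J`. -/
structure IdealWithRadical {P : Type*} [AddCommMonoid P] (J : Set P) where
  carrier : Set P
  isIdeal : IsMonoidIdeal carrier
  radical_eq : monoidRadical carrier = J

/-- `R_I = k[P] / I`. -/
def RI (k : Type*) {P : Type*} [Field k] [AddCommMonoid P] (I : Set P) : Type _ :=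
  AddMonoidAlgebra k P ⧸ Ideal.span ((fun a : P => (single a (1 : k) : AddMonoidAlgebra k P)) '' I)

instance {k P : Type*} [Field k] [AddCommMonoid P] (I : Set P) : CommRing (RI k I) :=
  inferInstanceAs (CommRing (AddMonoidAlgebra k P ⧸ Ideal.span _))

instance {k P : Type*} [Field k] [AddCommMonoid P] (I : Set P) : Algebra k (RI k I) :=
  inferInstanceAs (Algebra k (AddMonoidAlgebra k P ⧸ Ideal.span _))

/-- The quotient map `k[P] → R_I`. -/
def RI.mk {k P : Type*} [Field k] [AddCommMonoid P] (I : Set P) :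
    AddMonoidAlgebra k P →+* RI k I :=
  Ideal.Quotient.mk _

/-- The element `c t^β` of `R_I`. -/
def tmon {k P : Type*} [Field k] [AddCommMonoid P] (I : Set P) (β : P) (c : k) : RI k I :=
  RI.mk I (single β c)

/-! ## The tropicalization

`B` is obtained by gluing cyclically the cones `σ_j`, `j ∈ ℤ/r`, where `σ_j` is the standard
quadrant with edges `ρ_j = ℝ≥0 v_j` and `ρ_{j+1} = ℝ≥0 v_{j+1}`, in anticlockwise order.
Points of `σ_j` and integral tangent vectors on `σ_j` are given by their coordinates in the
basis `(v_j, v_{j+1})`. The integral linear structure across `ρ_j` is determined by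
`v_{j-1} + D_j² v_j + v_{j+1} = 0`. -/

/-- The tropicalization of a Looijenga pair with `r` boundary components, together with
a convex multivalued piecewise linear function `φ`. The integral linear structure on `B` is given
by the self-intersections `D_j²`, and `φ` (up to linear functions) by its kinks
`κ_j ∈ P` along the rays `ρ_j`. -/
structure TropData (r : ℕ) (P : Type*) where
  selfInt : ZMod r → ℤ
  kink : ZMod r → P

/-- The nonzero integral points of `B`: the triple `(j, a, b)` is `a v_j + b v_{j+1}`, with
`a > 0` and `b ≥ 0`, so that each point is represented exactly once. -/
abbrev B0Z (r : ℕ) : Type := ZMod r × ℕ+ × ℕ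

/-- The integral points of `B`; `none` is the origin. -/
abbrev BZ (r : ℕ) : Type := Option (B0Z r)

/-- The integral point `p` of `B` lies in the closed cone `σ_j`, with coordinates `m` there.
A point of the ray `ρ_i` lies both in `σ_i` and in `σ_{i-1}`. -/
def InCone {r : ℕ} (j : ZMod r) (m : ℤ × ℤ) : BZ r → Prop
  | none => m = 0
  | some (i, a, b) =>
      (j = i ∧ m = ((a : ℤ), (b : ℤ))) ∨ (b = 0 ∧ j + 1 = i ∧ m = (0, (a : ℤ)))

/-- The interior of a two-dimensional cone, in coordinates. -/
def openCone : Set (ℝ × ℝ) := {x | 0 < x.1 ∧ 0 < x.2}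

/-- A point of `σ_cone`, given by its coordinates. -/
structure Pt (r : ℕ) where
  cone : ZMod r
  pos : ℝ × ℝ

/-- The slope of a point in the interior of a cone. -/
def Pt.slope {r : ℕ} (Q : Pt r) : ℝ := Q.pos.2 / Q.pos.1

/-- `Q` is in the interior of a two-dimensional cone, and the line joining the origin and `Q` has
irrational slope. -/
def Pt.Generic {r : ℕ} (Q : Pt r) : Prop := Q.pos ∈ openCone ∧ Irrational Q.slope

/-- The symplectic pairing on integral tangent vectors of `σ_j`, normalized by
`⟨v_j, v_{j+1}⟩ = 1`. -/
def pair (m m' : ℤ × ℤ) : ℤ := m.1 * m'.2 - m.2 * m'.1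

/-- The primitive generator of the ray of slope `u ≥ 0` in `σ_j`; slope `0` is the ray `ρ_j`. -/
def primGen (u : ℚ) : ℤ × ℤ := ((u.den : ℤ), u.num)

/-! ## Scattering diagrams -/

/-- A ray `(𝔡, f_𝔡)`. The support `𝔡` is the ray of slope `slope ≥ 0` in `σ_cone` (the ray
`ρ_cone` if `slope = 0`), and `f_𝔡 = ∑ coeff (e, β) t^β X^e` with `X = z^{φ_τ(m_𝔡)}`, where `m_𝔡` is
the primitive generator of `𝔡` and `τ` the smallest cone containing `𝔡`. The constant
term is `1`; all other exponents of `X` are negative if the ray is outgoing and positive if it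
is ingoing. -/
structure Ray (r : ℕ) (k P : Type*) [Field k] [AddCommMonoid P] where
  cone : ZMod r
  slope : ℚ
  slope_nonneg : 0 ≤ slope
  outgoing : Prop
  coeff : ℤ × P → k
  coeff_zero : coeff (0, 0) = 1
  coeff_const : ∀ β, β ≠ 0 → coeff (0, β) = 0
  coeff_out : outgoing → ∀ e β, coeff (e, β) ≠ 0 → e ≤ 0
  coeff_in : ¬ outgoing → ∀ e β, coeff (e, β) ≠ 0 → 0 ≤ e

/-- `f_𝔡 ≠ 1` modulo `I`. -/
def Ray.NontrivialMod {r : ℕ} {k P : Type*} [Field k] [AddCommMonoid P]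
    (d : Ray r k P) (I : Set P) : Prop :=
  ∃ e β, e ≠ 0 ∧ β ∉ I ∧ d.coeff (e, β) ≠ 0

/-- The sum of the terms of `f_𝔡` whose exponent is not in `I` (a finite sum for the rays of
a scattering diagram), as an element of `k[ℤ × P]`, where `(e, β)` stands for `t^β X^e`. -/
def Ray.trunc {r : ℕ} {k P : Type*} [Field k] [AddCommMonoid P]
    (d : Ray r k P) (I : Set P) : AddMonoidAlgebra k (ℤ × P) :=
  ∑ᶠ s : {s : ℤ × P // s.2 ∉ I}, single s.1 (d.coeff s.1)

/-- A (classical) scattering diagram for the data `(B, Σ)`, `P`, `J`, `φ`. -/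
structure ScatteringDiagram {r : ℕ} {P : Type*} [AddCommMonoid P] (T : TropData r P)
    (J : Set P) (k : Type*) [Field k] where
  rays : Set (Ray r k P)
  /-- `f_𝔡` lies in the `J`-adic completion. -/
  finite_terms : ∀ d ∈ rays, ∀ I : IdealWithRadical J,
    {s : ℤ × P | s.2 ∉ I.carrier ∧ d.coeff s ≠ 0}.Finite
  trivial_mod : ∀ d ∈ rays, (0 < d.slope ∨ T.kink d.cone ∉ J) → ¬ d.NontrivialMod J
  finite_rays : ∀ I : IdealWithRadical J, {d ∈ rays | d.NontrivialMod I.carrier}.Finite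

section

variable {r : ℕ} {P k : Type*} [AddCommMonoid P] [Field k] {T : TropData r P} {J : Set P}
  (D : ScatteringDiagram T J k) (I : IdealWithRadical J)

/-- The slopes `u ≥ 0` such that the ray of slope `u` in `σ_j` is in `Supp_I(𝔇)`. -/
def walls (j : ZMod r) : Set ℚ :=
  {u | ∃ d ∈ D.rays, d.NontrivialMod I.carrier ∧ d.cone = j ∧ d.slope = u}

theorem walls_finite (j : ZMod r) : (walls D I j).Finite := by
  refine ((D.finite_rays I).image Ray.slope).subset ?_
  rintro u ⟨d, hd, hn, -, rfl⟩
  exact ⟨d, ⟨hd, hn⟩, rfl⟩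

/-- The product of the functions `f_𝔡`, over the finitely many rays nontrivial modulo `I` and with
support the ray of slope `u` in `σ_j`. -/
def wallFn (j : ZMod r) (u : ℚ) : AddMonoidAlgebra k (ℤ × P) :=
  ∏ᶠ d ∈ {d ∈ D.rays | d.NontrivialMod I.carrier ∧ d.cone = j ∧ d.slope = u}, d.trunc I.carrier

/-! ## Local models and gluing -/

/-- The monoid homomorphism `(e, β) ↦ t^β X^e`. -/
def laurentMon (k : Type*) [Field k] (I : Set P) :
    Multiplicative (ℤ × P) →* AddMonoidAlgebra (RI k I) ℤ where
  toFun s := single s.toAdd.1 (tmon I s.toAdd.2 1)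
  map_one' := by
    simp only [toAdd_one, Prod.fst_zero, Prod.snd_zero, tmon, ← one_def, map_one]
  map_mul' s s' := by
    simp only [toAdd_mul, Prod.fst_add, Prod.snd_add, tmon, single_mul_single, ← map_mul, mul_one]

/-- The map `k[ℤ × P] → R_I[X, X⁻¹]`. -/
def toLaurent (k : Type*) [Field k] (I : Set P) :
    AddMonoidAlgebra k (ℤ × P) →ₐ[k] AddMonoidAlgebra (RI k I) ℤ :=
  AddMonoidAlgebra.lift k _ _ (laurentMon k I)

/-- `f_ρ = f_{ρ, out} f_{ρ, in} ∈ R_I[X, X⁻¹]` for `ρ = ρ_j`, and more generally the product of the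
functions on the ray of slope `u` in `σ_j`. -/
def wallLaurent (j : ZMod r) (u : ℚ) : AddMonoidAlgebra (RI k I.carrier) ℤ :=
  toLaurent k I.carrier (wallFn D I j u)

/-- `R_{σ,I} = k[P_{φ_σ}] / I = R_I[ℤ²]`, where `t^β z^m` stands for the monomial of exponent
`β + φ_σ(m)`, for `m` in the basis `(v_j, v_{j+1})`, `σ = σ_j`. -/
abbrev Rsigma (k : Type*) {P : Type*} [Field k] [AddCommMonoid P] (I : Set P) : Type _ :=
  AddMonoidAlgebra (RI k I) (ℤ × ℤ)

/-- `R_I[X, X⁻¹] → R_{σ,I}`, `X ↦ z^m`. -/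
def subst (k : Type*) [Field k] (I : Set P) (m : ℤ × ℤ) :
    AddMonoidAlgebra (RI k I) ℤ →ₐ[RI k I] Rsigma k I :=
  AddMonoidAlgebra.mapDomainAlgHom (RI k I) (RI k I) (zmultiplesHom (ℤ × ℤ) m)

/-- The relation `X₊ X₋ - t^κ f_ρ(X) X^{-D_ρ²}`, where `X₊ = X 0` and `X₋ = X 1`. -/
def rhoRel (j : ZMod r) : MvPolynomial (Fin 2) (AddMonoidAlgebra (RI k I.carrier) ℤ) :=
  MvPolynomial.X 0 * MvPolynomial.X 1
    - MvPolynomial.C (single (-T.selfInt j) (tmon I.carrier (T.kink j) 1) * wallLaurent D I j 0)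

/-- `R_{ρ,I} = R_I[X₊, X₋, X, X⁻¹] / (X₊ X₋ - t^κ f_ρ(X) X^{-D_ρ²})` for `ρ = ρ_j`. -/
def Rrho (j : ZMod r) : Type _ :=
  MvPolynomial (Fin 2) (AddMonoidAlgebra (RI k I.carrier) ℤ) ⧸ Ideal.span {rhoRel D I j}

instance (j : ZMod r) : CommRing (Rrho D I j) :=
  inferInstanceAs (CommRing
    (MvPolynomial (Fin 2) (AddMonoidAlgebra (RI k I.carrier) ℤ) ⧸ Ideal.span _))

instance (j : ZMod r) : Algebra (RI k I.carrier) (Rrho D I j) :=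
  inferInstanceAs (Algebra (RI k I.carrier)
    (MvPolynomial (Fin 2) (AddMonoidAlgebra (RI k I.carrier) ℤ) ⧸ Ideal.span _))

/-- The `R_I`-algebra map `R_I[X₊, X₋, X, X⁻¹] → R_{σ,I}` with `X ↦ z^m`, `X₊ ↦ xp`, `X₋ ↦ xm`. -/
def evalGens (k : Type*) [Field k] (I : Set P) (m : ℤ × ℤ) (xp xm : Rsigma k I) :
    MvPolynomial (Fin 2) (AddMonoidAlgebra (RI k I) ℤ) →ₐ[RI k I] Rsigma k I where
  toRingHom := MvPolynomial.eval₂Hom (subst k I m).toRingHom ![xp, xm]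
  commutes' c := by
    change MvPolynomial.eval₂ _ _ (algebraMap _ _ c) = _
    rw [MvPolynomial.algebraMap_apply, MvPolynomial.eval₂_C]
    exact (subst k I m).commutes c

theorem evalGens_X (k : Type*) [Field k] (I : Set P) (m : ℤ × ℤ) (xp xm : Rsigma k I)
    (i : Fin 2) : evalGens k I m xp xm (MvPolynomial.X i) = ![xp, xm] i :=
  MvPolynomial.eval₂_X _ _ _

theorem evalGens_C (k : Type*) [Field k] (I : Set P) (m : ℤ × ℤ) (xp xm : Rsigma k I)
    (a : AddMonoidAlgebra (RI k I) ℤ) :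
    evalGens k I m xp xm (MvPolynomial.C a) = subst k I m a :=
  MvPolynomial.eval₂_C _ _ _

theorem subst_single (k : Type*) [Field k] (I : Set P) (m : ℤ × ℤ) (e : ℤ) (c : RI k I) :
    subst k I m (single e c) = single (e • m) c := by
  simp only [subst, mapDomainAlgHom_apply, mapDomain_single, zmultiplesHom_apply]

/-- The restriction `ψ_{ρ,+} : R_{ρ,I} → R_{σ₊,I}`, `ρ = ρ_j`, `σ₊ = σ_j`, with `X ↦ z^{v_j}`,
`X₊ ↦ z^{v_{j+1}}`, `X₋ ↦ f_ρ(X) z^{φ_ρ(v_{j-1})}`. Here `v_{j-1} = -D_j² v_j - v_{j+1}` and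
`φ_ρ(v_{j-1}) = κ_j + φ_{σ₊}(v_{j-1})`. -/
def psiPlus (j : ZMod r) : Rrho D I j →ₐ[RI k I.carrier] Rsigma k I.carrier :=
  Ideal.Quotient.liftₐ (Ideal.span {rhoRel D I j})
    (evalGens k I.carrier (1, 0) (single (0, 1) 1)
      (subst k I.carrier (1, 0) (wallLaurent D I j 0)
        * single (-T.selfInt j, -1) (tmon I.carrier (T.kink j) 1)))
    (by
      intro a ha
      obtain ⟨b, rfl⟩ := Ideal.mem_span_singleton'.mp ha
      rw [map_mul]
      have h : evalGens k I.carrier (1, 0) (single (0, 1) 1)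
          (subst k I.carrier (1, 0) (wallLaurent D I j 0)
            * single (-T.selfInt j, -1) (tmon I.carrier (T.kink j) 1)) (rhoRel D I j) = 0 := by
        rw [rhoRel, map_sub, map_mul, evalGens_X, evalGens_X, evalGens_C, map_mul, subst_single,
          sub_eq_zero]
        simp only [Matrix.cons_val_zero, Matrix.cons_val_one]
        rw [mul_left_comm]
        rw [single_mul_single]
        simp [mul_comm]
      rw [h, mul_zero])

/-- The restriction `ψ_{ρ,-} : R_{ρ,I} → R_{σ₋,I}`, `ρ = ρ_j`, `σ₋ = σ_{j-1}`, with `X ↦ z^{v_j}`,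
`X₋ ↦ z^{v_{j-1}}`, `X₊ ↦ f_ρ(X) z^{φ_ρ(v_{j+1})}`, in the basis `(v_{j-1}, v_j)`. Here
`v_{j+1} = -v_{j-1} - D_j² v_j` and `φ_ρ(v_{j+1}) = κ_j + φ_{σ₋}(v_{j+1})`. -/
def psiMinus (j : ZMod r) : Rrho D I j →ₐ[RI k I.carrier] Rsigma k I.carrier :=
  Ideal.Quotient.liftₐ (Ideal.span {rhoRel D I j})
    (evalGens k I.carrier (0, 1)
      (subst k I.carrier (0, 1) (wallLaurent D I j 0)
        * single (-1, -T.selfInt j) (tmon I.carrier (T.kink j) 1))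
      (single (1, 0) 1))
    (by
      intro a ha
      obtain ⟨b, rfl⟩ := Ideal.mem_span_singleton'.mp ha
      rw [map_mul]
      have h : evalGens k I.carrier (0, 1)
          (subst k I.carrier (0, 1) (wallLaurent D I j 0)
            * single (-1, -T.selfInt j) (tmon I.carrier (T.kink j) 1))
          (single (1, 0) 1) (rhoRel D I j) = 0 := by
        rw [rhoRel, map_sub, map_mul, evalGens_X, evalGens_X, evalGens_C, map_mul, subst_single,
          sub_eq_zero]
        simp only [Matrix.cons_val_zero, Matrix.cons_val_one]
        rw [mul_assoc]
        rw [single_mul_single]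
        simp [mul_comm]
      rw [h, mul_zero])

open Classical in
/-- The function on the ray of slope `u > 0` in `σ_j` as a unit of `R_{σ,I}` (it is a unit, being
equal to `1` modulo the nilpotent ideal `J`). -/
def wallUnit (j : ZMod r) (u : ℚ) : (Rsigma k I.carrier)ˣ :=
  if h : IsUnit (subst k I.carrier (primGen u) (wallLaurent D I j u)) then h.unit else 1

/-- The automorphism `z^m ↦ z^m f^{-⟨m_𝔡, m⟩}` of `R_{σ,I}` for crossing anticlockwise the ray `𝔡` of
slope `u > 0` in `σ = σ_j`. -/
def wallCross (j : ZMod r) (u : ℚ) :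
    Rsigma k I.carrier →ₐ[RI k I.carrier] Rsigma k I.carrier :=
  AddMonoidAlgebra.lift (RI k I.carrier) _ (ℤ × ℤ)
    { toFun := fun m => single m.toAdd 1
        * ((wallUnit D I j u ^ (-pair (primGen u) m.toAdd) : (Rsigma k I.carrier)ˣ) :
            Rsigma k I.carrier)
      map_one' := by
        simp [pair, one_def]
      map_mul' := by
        intro m m'
        have h : -pair (primGen u) (m * m').toAdd
            = -pair (primGen u) m.toAdd + -pair (primGen u) m'.toAdd := by
          simp only [pair, toAdd_mul, Prod.fst_add, Prod.snd_add]; ring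
        rw [h, zpow_add, Units.val_mul, toAdd_mul, ← mul_one (1 : RI k I.carrier),
          ← single_mul_single, mul_one]
        ring }

open Classical in
/-- The composition `θ_{𝔡_n} ∘ ⋯ ∘ θ_{𝔡_1}`, for an anticlockwise path in the interior of `σ_j` crossing,
in this order, the rays `𝔡_1, …, 𝔡_n` of `Supp_I(𝔇)` with slope in `S`. -/
def pathAut (j : ZMod r) (S : Set ℝ) :
    Rsigma k I.carrier →ₐ[RI k I.carrier] Rsigma k I.carrier :=
  ((((walls_finite D I j).toFinset.filter fun u : ℚ => (u : ℝ) ∈ S).sort (· ≤ ·)).foldl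
    (fun Φ u => (wallCross D I j u).comp Φ) (AlgHom.id _ _))

/-- `A_I`, the ring of global functions on the scheme `X_I°` obtained by gluing the
`Spec R_{ρ_j,I}` along their open subschemes `Spec R_{σ_j,I}` by the automorphisms of the paths
crossing `σ_j` from `ρ_j` to `ρ_{j+1}`. -/
def AI : Subalgebra (RI k I.carrier) (∀ j : ZMod r, Rrho D I j) :=
  ⨅ j : ZMod r, AlgHom.equalizer
    (((pathAut D I j (Set.Ioi 0)).comp (psiPlus D I j)).comp
      (Pi.evalAlgHom (RI k I.carrier) (fun j => Rrho D I j) j))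
    ((psiMinus D I (j + 1)).comp
      (Pi.evalAlgHom (RI k I.carrier) (fun j => Rrho D I j) (j + 1)))

/-! ## Broken lines -/

/-- A segment of a broken line: its cone `σ_cone`, the attached monomial
`coeff t^expP z^exp` (of exponent `expP + φ_σ(exp)`), and its final point, in the
coordinates of `σ_cone`. -/
structure Segment (r : ℕ) (k P : Type*) where
  cone : ZMod r
  coeff : k
  expP : P
  exp : ℤ × ℤ
  endPt : ℝ × ℝ

/-- The point of `ℝ²` reached from `x` at time `t` with velocity `-m`. -/
def flow (x : ℝ × ℝ) (m : ℤ × ℤ) (t : ℝ) : ℝ × ℝ := (x.1 - t * m.1, x.2 - t * m.2)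

/-- The segment `s` starts at `x` and, with velocity the opposite of its exponent, reaches its end
point after a positive time, staying in the interior of its cone in between. -/
def Segment.StartsAt (s : Segment r k P) (x : ℝ × ℝ) : Prop :=
  ∃ t : ℝ, 0 < t ∧ flow x s.exp t = s.endPt ∧ ∀ t' ∈ Set.Ioo 0 t, flow x s.exp t' ∈ openCone

/-- `c t^β X^e` is a nonzero term, with `β ∉ I`, in the expansion of the `n`-th power of the product
of the functions on the ray of slope `u` in `σ_j`. -/
def IsTerm (j : ZMod r) (u : ℚ) (n : ℕ) (e : ℤ) (β : P) (c : k) : Prop :=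
  β ∉ I.carrier ∧ c ≠ 0 ∧ (wallFn D I j u ^ n).coeff (e, β) = c

/-- Passing from a segment `s` to the next one `s'`: either a bend on a ray contained in
the interior of a cone, or the crossing of a ray of `Σ`, where the line may bend too and where
exponents are rewritten in the coordinates of the new cone. -/
inductive Step : Segment r k P → Segment r k P → Prop
  | bend (s s' : Segment r k P) (u : ℚ) (e : ℤ) (β : P) (c : k)
      (hu : 0 < u) (hpos : 0 < s.endPt.1) (hon : s.endPt.2 = u * s.endPt.1)
      (hne : (e, β) ≠ (0, 0))
      (hterm : IsTerm D I s.cone u (pair (primGen u) s.exp).natAbs e β c)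
      (hcone : s'.cone = s.cone)
      (hcoeff : s'.coeff = s.coeff * c)
      (hexpP : s'.expP = s.expP + β)
      (hexp : s'.exp = s.exp + e • primGen u)
      (hstart : s'.StartsAt s.endPt) : Step s s'
  | crossAnticlockwise (s s' : Segment r k P) (e : ℤ) (β : P) (c : k)
      (hpos : 0 < s.endPt.2) (hon : s.endPt.1 = 0) (hdir : 0 < s.exp.1)
      (hterm : IsTerm D I (s.cone + 1) 0 s.exp.1.toNat e β c)
      (hcone : s'.cone = s.cone + 1)
      (hcoeff : s'.coeff = s.coeff * c)
      (hexpP : s'.expP = s.expP + s.exp.1.toNat • T.kink (s.cone + 1) + β)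
      (hexp : s'.exp = (s.exp.2 - T.selfInt (s.cone + 1) * s.exp.1 + e, -s.exp.1))
      (hstart : s'.StartsAt (s.endPt.2, 0)) : Step s s'
  | crossClockwise (s s' : Segment r k P) (e : ℤ) (β : P) (c : k)
      (hpos : 0 < s.endPt.1) (hon : s.endPt.2 = 0) (hdir : 0 < s.exp.2)
      (hterm : IsTerm D I s.cone 0 s.exp.2.toNat e β c)
      (hcone : s'.cone + 1 = s.cone)
      (hcoeff : s'.coeff = s.coeff * c)
      (hexpP : s'.expP = s.expP + s.exp.2.toNat • T.kink s.cone + β)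
      (hexp : s'.exp = (-s.exp.2, s.exp.1 - T.selfInt s.cone * s.exp.2 + e))
      (hstart : s'.StartsAt (0, s.endPt.1)) : Step s s'

/-- Broken lines of asymptotic charge `p` ending at `Q`, using only terms not in `I` at their bends,
given by their successive segments. The first segment is a half-line coming from infinity in a
cone `σ` containing `p`, with attached monomial `z^{φ_σ(p)}`. -/
@[ext]
structure BrokenLine (p : BZ r) (Q : Pt r) where
  first : Segment r k P
  tail : List (Segment r k P)
  charge_ne : p ≠ none
  first_coeff : first.coeff = 1
  first_expP : first.expP = 0
  first_exp : InCone first.cone first.exp p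
  first_unbounded : ∀ t : ℝ, t < 0 → flow first.endPt first.exp t ∈ openCone
  chain : List.IsChain (Step D I) (first :: tail)
  last_cone : ((first :: tail).getLast (List.cons_ne_nil _ _)).cone = Q.cone
  last_endPt : ((first :: tail).getLast (List.cons_ne_nil _ _)).endPt = Q.pos

variable {D I}

/-- The last segment of a broken line. -/
def BrokenLine.last {p : BZ r} {Q : Pt r} (γ : BrokenLine D I p Q) : Segment r k P :=
  (γ.first :: γ.tail).getLast (List.cons_ne_nil _ _)

/-- The final coefficient `c(γ)`, in `R_I`. -/
def BrokenLine.c {p : BZ r} {Q : Pt r} (γ : BrokenLine D I p Q) : RI k I.carrier :=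
  tmon I.carrier γ.last.expP γ.last.coeff

/-- The final exponent `s(γ)`, in the basis `(v_j, v_{j+1})` if `Q ∈ σ_j`. -/
def BrokenLine.s {p : BZ r} {Q : Pt r} (γ : BrokenLine D I p Q) : ℤ × ℤ := γ.last.exp

variable (D I)

/-- `Lift_Q(p) = ∑_γ Mono(γ)`, the sum over the broken lines of charge `p` ending at `Q`. -/
def lift (p : BZ r) (Q : Pt r) : Rsigma k I.carrier :=
  ∑ᶠ γ : BrokenLine D I p Q, single γ.s γ.c

/-- No ray of `Supp_I(𝔇)` lies strictly between `ρ_j` and `Q`, for `Q` in the interior of `σ_j`. -/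
def NearFirstEdge (Q : Pt r) : Prop :=
  ∀ u ∈ walls D I Q.cone, 0 < u → Q.slope ≤ (u : ℝ)

/-- No ray of `Supp_I(𝔇)` lies strictly between `Q` and `ρ_{j+1}`, for `Q` in the interior of `σ_j`. -/
def NearSecondEdge (Q : Pt r) : Prop :=
  ∀ u ∈ walls D I Q.cone, 0 < u → (u : ℝ) ≤ Q.slope

/-- Consistency of `𝔇` modulo `I`: compatibility of the `Lift_Q(p)` under wall crossing inside each
cone (an anticlockwise path is enough, other paths give the inverse relation or a
composition), and across each ray of `Σ`. -/
def ConsistentMod : Prop :=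
  ∀ p : B0Z r,
    (∀ Q Q' : Pt r, Q.Generic → Q'.Generic → Q'.cone = Q.cone → Q.slope < Q'.slope →
      lift D I (some p) Q' = pathAut D I Q.cone (Set.Ioo Q.slope Q'.slope) (lift D I (some p) Q)) ∧
    (∀ Qm Qp : Pt r, Qm.Generic → Qp.Generic → Qp.cone = Qm.cone + 1 →
      NearSecondEdge D I Qm → NearFirstEdge D I Qp →
      ∃ L : Rrho D I Qp.cone,
        psiPlus D I Qp.cone L = lift D I (some p) Qp ∧
        psiMinus D I Qp.cone L = lift D I (some p) Qm)

/-- Consistent scattering diagrams. -/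
def Consistent : Prop := ∀ I : IdealWithRadical J, ConsistentMod D I

/-- The family `(ϑ_p)` of elements of `A_I` is the family of theta functions: `ϑ_0 = 1`, and
for `p ≠ 0` the local expressions of `ϑ_p` on the chart of `ρ_j` restrict to `Lift_Q(p)`, for `Q`
close to `ρ_j` on both sides of `ρ_j`. -/
def IsTheta (ϑ : BZ r → AI D I) : Prop :=
  ϑ none = 1 ∧ ∀ (p : B0Z r) (Q : Pt r), Q.Generic →
    (NearFirstEdge D I Q → psiPlus D I Q.cone ((ϑ (some p)).1 Q.cone) = lift D I (some p) Q) ∧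
    (NearSecondEdge D I Q →
      psiMinus D I (Q.cone + 1) ((ϑ (some p)).1 (Q.cone + 1)) = lift D I (some p) Q)

/-! ## Poisson brackets -/

/-- The Poisson bracket on `R[ℤ²]`, `{z^m, z^m'} = ⟨m, m'⟩ z^{m+m'}`, `R`-bilinear. -/
def torusBracket {R : Type*} [CommRing R] (f g : AddMonoidAlgebra R (ℤ × ℤ)) :
    AddMonoidAlgebra R (ℤ × ℤ) :=
  f.coeff.sum fun m a => g.coeff.sum fun m' b =>
    single (m + m') (((pair m m' : ℤ) : R) * (a * b))

/-- An `R`-bilinear Poisson bracket on a commutative `R`-algebra. -/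
structure IsPoissonBracket {R A : Type*} [CommRing R] [CommRing A] [Algebra R A]
    (br : A →ₗ[R] A →ₗ[R] A) : Prop where
  skew : ∀ a b, br a b = -br b a
  leibniz : ∀ a b c, br a (b * c) = br a b * c + br a c * b
  jacobi : ∀ a b c, br a (br b c) + br b (br c a) + br c (br a b) = 0

/-- A bracket on `A_I` is compatible with the Poisson brackets of all the charts `Spec R_{σ,I}`
of `X_I°`. -/
def IsGlobalBracket (br : AI D I →ₗ[RI k I.carrier] AI D I →ₗ[RI k I.carrier] AI D I) : Prop :=
  ∀ (a b : AI D I) (j : ZMod r),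
    psiPlus D I j ((br a b).1 j) = torusBracket (psiPlus D I j (a.1 j)) (psiPlus D I j (b.1 j)) ∧
    psiMinus D I j ((br a b).1 j) = torusBracket (psiMinus D I j (a.1 j)) (psiMinus D I j (b.1 j))

/-- `z` is a generic point very close to `p ∈ B(ℤ)`: `z` is in the interior of a two-dimensional
cone `σ` containing `p`, with irrational slope, and the segment from `p` to `z` does not meet
`Supp_I(𝔇)`, except possibly at `p`. Here `m` is the vector of coordinates of `p` in `σ`. -/
def CloseTo (p : BZ r) (z : Pt r) (m : ℤ × ℤ) : Prop :=
  z.Generic ∧ InCone z.cone m p ∧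
    ∀ t : ℝ, 0 < t → t ≤ 1 → ∀ u ∈ walls D I z.cone, 0 < u →
      (1 - t) * m.2 + t * z.pos.2 ≠ u * ((1 - t) * m.1 + t * z.pos.1)

/-- Pairs of broken lines of charges `p₁`, `p₂` ending at `z` with `s(γ₁) + s(γ₂) = m`. -/
abbrev BrokenPairs (p₁ p₂ : BZ r) (z : Pt r) (m : ℤ × ℤ) : Type _ :=
  {γ : BrokenLine D I p₁ z × BrokenLine D I p₂ z // γ.1.s + γ.2.s = m}

variable {D I}

/-- The contribution `⟨s(γ₁), s(γ₂)⟩ c(γ₁) c(γ₂)` of a pair of broken lines. -/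
def pairTerm {p₁ p₂ : BZ r} {z : Pt r} {m : ℤ × ℤ} (γ : BrokenPairs D I p₁ p₂ z m) :
    RI k I.carrier :=
  ((pair γ.1.1.s γ.1.2.s : ℤ) : RI k I.carrier) * (γ.1.1.c * γ.1.2.c)

variable (D I)

/-- `P^p_{p₁,p₂} = ∑ ⟨s(γ₁), s(γ₂)⟩ c(γ₁) c(γ₂)`, computed at the point `z`, where `m` is the
vector of coordinates of `p` in the cone of `z`. -/
def poissonCoeff (p₁ p₂ : BZ r) (z : Pt r) (m : ℤ × ℤ) : RI k I.carrier :=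
  ∑ᶠ γ : BrokenPairs D I p₁ p₂ z m, pairTerm γ

end

end LPMirror

end

open LPMirror

noncomputable section

namespace LPMirror

open AddMonoidAlgebra

/-! ### Laurent polynomials with coefficients in an ideal of the base ring -/

section CoeffIdeal

variable {R G : Type*} [CommRing R] [AddCommMonoid G]

/-! The monomials `t^β` with `β ∈ J` generate a nilpotent ideal of `R_I` (`monoIdeal_pow_eq_bot`).
Orders of vanishing are measured coefficientwise along its powers. Modulo this ideal, walls inside a
cone are trivial and the relation at `ρ_j` becomes `X₊ X₋ = 0`, because the kinks lie in `J`.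

The bracket. `R_{ρ,I}` embeds in the product of the rings on the two sides of `ρ` (`psi_injective`),
so it has at most one compatible bracket. One exists because the brackets of the generators `X`,
`X₊`, `X₋` lift to `R_{ρ,I}`, and liftability is preserved by sums, products and scalars
(`hasBracket`). Wall crossings are Poisson automorphisms (`wallCross_bracket`), so the local
brackets glue. The Poisson identities are inherited from the torus.

Finiteness. Each passage between segments of a broken line contributes a factor in the nilpotent
ideal, so lines with nonzero final coefficient have boundedly many segments. Their successive
monomials take finitely many values, and the bending points are recovered backwards from the end
point (`finite_brokenLines`).

Spanning. Modulo the nilpotent ideal, `ϑ_p` is `z^p` on the cones containing `p` and `0` on the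
others, and a global function is determined by its coefficients at integral points of `B`.
Subtracting the theta combination with these coefficients gains one power of the ideal
(`exists_sub_sum_mem`). Iterating shows that theta functions span `A_I` (`IsTheta.mem_span`).

Structure constants. A broken line ending at `z_p` with final exponent `p` has no bend: traced
backwards in direction `p`, it stays in its cone and meets no wall (`BrokenLine.tail_eq_nil`). So
the coefficient of `z^p` in the local expression of `ϑ_q` at `z_p` is `1` if `p = q` and `0`
otherwise (`IsTheta.localExpr_coeff`). Taking the coefficient of `z^p` at `z_p` thus reads off the
coefficient of `ϑ_p` in any theta combination. Applied to the bracket, which is computed at `z_p`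
from the two lifts, it gives the sum over pairs of broken lines (`torusBracket_lift_coeff`). -/

theorem coeff_mul_mem {𝔞 𝔟 : Ideal R} {f g : AddMonoidAlgebra R G}
    (hf : ∀ m, f.coeff m ∈ 𝔞) (hg : ∀ m, g.coeff m ∈ 𝔟) (m : G) :
    (f * g).coeff m ∈ 𝔞 * 𝔟 := by
  classical
  rw [coeff_mul]
  refine Ideal.sum_mem _ fun a _ => Ideal.sum_mem _ fun b _ => ?_
  dsimp only
  split_ifs
  · exact Ideal.mul_mem_mul (hf a) (hg b)
  · exact zero_mem _

variable (G) in
/-- The ideal of the elements of `R[G]` with all coefficients in `𝔞`. -/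
def coeffIdeal (𝔞 : Ideal R) : Ideal (AddMonoidAlgebra R G) where
  carrier := {f | ∀ m, f.coeff m ∈ 𝔞}
  add_mem' hf hg m := by
    rw [coeff_add]; exact add_mem (hf m) (hg m)
  zero_mem' m := by simp
  smul_mem' c f hf m := by
    have := coeff_mul_mem (𝔞 := ⊤) (f := c) (fun _ => trivial) hf m
    rwa [Ideal.top_mul] at this

theorem mul_mem_coeffIdeal {𝔞 𝔟 : Ideal R} {f g : AddMonoidAlgebra R G}
    (hf : f ∈ coeffIdeal G 𝔞) (hg : g ∈ coeffIdeal G 𝔟) : f * g ∈ coeffIdeal G (𝔞 * 𝔟) :=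
  coeff_mul_mem hf hg

theorem single_mem_coeffIdeal {𝔞 : Ideal R} {c : R} (hc : c ∈ 𝔞) (m : G) :
    single m c ∈ coeffIdeal G 𝔞 := by
  classical
  intro n
  rw [coeff_single, Finsupp.single_apply]
  split_ifs
  · exact hc
  · exact zero_mem _

theorem coeffIdeal_bot {f : AddMonoidAlgebra R G} (hf : f ∈ coeffIdeal G (⊥ : Ideal R)) :
    f = 0 := by
  ext m
  simpa using hf m

theorem coeffIdeal_induction {𝔞 : Ideal R} {f : AddMonoidAlgebra R G}
    (hf : f ∈ coeffIdeal G 𝔞) {S : Type*} [AddCommGroup S] (L : AddMonoidAlgebra R G →+ S)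
    (T : AddSubgroup S) (h : ∀ m, ∀ c ∈ 𝔞, L (single m c) ∈ T) : L f ∈ T := by
  rw [← sum_coeff_single f, Finsupp.sum, map_sum]
  exact sum_mem fun m _ => h m _ (hf m)

theorem algHom_mem_coeffIdeal {H : Type*} [AddCommMonoid H] {𝔞 : Ideal R}
    {f : AddMonoidAlgebra R G} (hf : f ∈ coeffIdeal G 𝔞)
    (L : AddMonoidAlgebra R G →ₐ[R] AddMonoidAlgebra R H) : L f ∈ coeffIdeal H 𝔞 := by
  refine coeffIdeal_induction hf L.toRingHom.toAddMonoidHom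
    (coeffIdeal H 𝔞).toAddSubgroup fun m c hc => ?_
  change L (single m c) ∈ coeffIdeal H 𝔞
  have h : single m c = c • (single m 1 : AddMonoidAlgebra R G) := by
    rw [smul_single, smul_eq_mul, mul_one]
  rw [h, map_smul]
  intro n
  rw [coeff_smul_apply]
  exact Ideal.mul_mem_right _ _ hc

end CoeffIdeal

/-! ### The Poisson bracket of the torus -/

section TorusBracket

variable {R : Type*} [CommRing R]

theorem pair_add_right (a b c : ℤ × ℤ) : pair a (b + c) = pair a b + pair a c := by
  simp only [pair, Prod.fst_add, Prod.snd_add]; ring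

theorem pair_swap (a b : ℤ × ℤ) : pair a b = -pair b a := by
  simp only [pair]; ring

theorem pair_smul_left (n : ℤ) (a b : ℤ × ℤ) : pair (n • a) b = n * pair a b := by
  simp only [pair, Prod.smul_fst, Prod.smul_snd, smul_eq_mul]; ring

theorem pair_smul_right (n : ℤ) (a b : ℤ × ℤ) : pair a (n • b) = n * pair a b := by
  simp only [pair, Prod.smul_fst, Prod.smul_snd, smul_eq_mul]; ring

theorem torusBracket_single (m m' : ℤ × ℤ) (a b : R) :
    torusBracket (single m a) (single m' b)
      = single (m + m') (((pair m m' : ℤ) : R) * (a * b)) := by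
  unfold torusBracket
  rw [coeff_single, Finsupp.sum_single_index, coeff_single, Finsupp.sum_single_index]
  · simp
  · simp

theorem torusBracket_add_left (f f' g : AddMonoidAlgebra R (ℤ × ℤ)) :
    torusBracket (f + f') g = torusBracket f g + torusBracket f' g := by
  unfold torusBracket
  rw [coeff_add, Finsupp.sum_add_index']
  · intro m; simp
  · intro m a a'
    rw [← Finsupp.sum_add]
    refine Finsupp.sum_congr fun m' _ => ?_
    rw [← single_add]; congr 1; ring

theorem torusBracket_add_right (f g g' : AddMonoidAlgebra R (ℤ × ℤ)) :
    torusBracket f (g + g') = torusBracket f g + torusBracket f g' := by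
  unfold torusBracket
  rw [← Finsupp.sum_add]
  refine Finsupp.sum_congr fun m _ => ?_
  rw [coeff_add, Finsupp.sum_add_index']
  · intro m; simp
  · intro m' a a'
    rw [← single_add]; congr 1; ring

theorem torusBracket_zero_left (g : AddMonoidAlgebra R (ℤ × ℤ)) : torusBracket 0 g = 0 := by
  simp [torusBracket]

theorem torusBracket_zero_right (g : AddMonoidAlgebra R (ℤ × ℤ)) : torusBracket g 0 = 0 := by
  simp [torusBracket]

theorem torusBracket_swap (f g : AddMonoidAlgebra R (ℤ × ℤ)) :
    torusBracket f g = -torusBracket g f := by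
  induction f using induction_linear with
  | zero => simp [torusBracket_zero_left, torusBracket_zero_right]
  | add f f' hf hf' =>
    rw [torusBracket_add_left, torusBracket_add_right, hf, hf']; abel
  | single m a =>
    induction g using induction_linear with
    | zero => simp [torusBracket_zero_left, torusBracket_zero_right]
    | add f f' hf hf' =>
      rw [torusBracket_add_left, torusBracket_add_right, hf, hf']; abel
    | single m' b =>
      rw [torusBracket_single, torusBracket_single, pair_swap, add_comm m', ← single_neg]
      congr 1; push_cast; ring

theorem torusBracket_self (f : AddMonoidAlgebra R (ℤ × ℤ)) : torusBracket f f = 0 := by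
  induction f using induction_linear with
  | zero => exact torusBracket_zero_left _
  | add f f' hf hf' =>
    rw [torusBracket_add_left, torusBracket_add_right, torusBracket_add_right, hf, hf',
      torusBracket_swap f' f]
    abel
  | single m a => rw [torusBracket_single]; simp [pair, mul_comm]

theorem torusBracket_smul_left (c : R) (f g : AddMonoidAlgebra R (ℤ × ℤ)) :
    torusBracket (c • f) g = c • torusBracket f g := by
  induction f using induction_linear with
  | zero => simp [torusBracket_zero_left]
  | add f f' hf hf' => rw [smul_add, torusBracket_add_left, hf, hf', torusBracket_add_left,
      smul_add]
  | single m a =>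
    induction g using induction_linear with
    | zero => simp [torusBracket_zero_right]
    | add f f' hf hf' => rw [torusBracket_add_right, hf, hf', torusBracket_add_right, smul_add]
    | single m' b =>
      rw [smul_single, torusBracket_single, torusBracket_single, smul_single]
      congr 1; simp only [smul_eq_mul]; ring

theorem torusBracket_smul_right (c : R) (f g : AddMonoidAlgebra R (ℤ × ℤ)) :
    torusBracket f (c • g) = c • torusBracket f g := by
  rw [torusBracket_swap, torusBracket_smul_left, torusBracket_swap g, smul_neg, neg_neg]

/-- The bracket as a bilinear map. -/
def torusBracketₗ : AddMonoidAlgebra R (ℤ × ℤ) →ₗ[R] AddMonoidAlgebra R (ℤ × ℤ) →ₗ[R]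
    AddMonoidAlgebra R (ℤ × ℤ) :=
  LinearMap.mk₂ R torusBracket torusBracket_add_left torusBracket_smul_left
    torusBracket_add_right torusBracket_smul_right

theorem torusBracketₗ_apply (f g : AddMonoidAlgebra R (ℤ × ℤ)) :
    torusBracketₗ f g = torusBracket f g := rfl

theorem torusBracket_mul_right (f g h : AddMonoidAlgebra R (ℤ × ℤ)) :
    torusBracket f (g * h) = torusBracket f g * h + torusBracket f h * g := by
  induction f using induction_linear with
  | zero => simp [torusBracket_zero_left]
  | add f f' hf hf' => simp only [torusBracket_add_left, hf, hf']; ring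
  | single m a =>
    induction g using induction_linear with
    | zero => simp [torusBracket_zero_right]
    | add f f' hf hf' => simp only [torusBracket_add_right, add_mul, mul_add, hf, hf']; ring
    | single m' b =>
      induction h using induction_linear with
      | zero => simp [torusBracket_zero_right]
      | add f f' hf hf' => simp only [torusBracket_add_right, add_mul, mul_add, hf, hf']; ring
      | single m'' c =>
        simp only [single_mul_single, torusBracket_single, pair_add_right]
        rw [add_right_comm m m'' m', ← add_assoc, ← single_add]
        congr 1; push_cast; ring

theorem torusBracket_mul_left (f g h : AddMonoidAlgebra R (ℤ × ℤ)) :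
    torusBracket (g * h) f = torusBracket g f * h + torusBracket h f * g := by
  rw [torusBracket_swap, torusBracket_mul_right, torusBracket_swap f g, torusBracket_swap f h]
  ring

theorem torusBracket_jacobi (f g h : AddMonoidAlgebra R (ℤ × ℤ)) :
    torusBracket f (torusBracket g h) + torusBracket g (torusBracket h f)
      + torusBracket h (torusBracket f g) = 0 := by
  induction f using induction_linear with
  | zero => simp [torusBracket_zero_left, torusBracket_zero_right]
  | add f f' hf hf' =>
    have := congrArg₂ (· + ·) hf hf'
    simp only [torusBracket_add_left, torusBracket_add_right, add_zero] at this ⊢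
    rw [← this]; abel
  | single m a =>
    induction g using induction_linear with
    | zero => simp [torusBracket_zero_left, torusBracket_zero_right]
    | add f f' hf hf' =>
      have := congrArg₂ (· + ·) hf hf'
      simp only [torusBracket_add_left, torusBracket_add_right, add_zero] at this ⊢
      rw [← this]; abel
    | single m' b =>
      induction h using induction_linear with
      | zero => simp [torusBracket_zero_left, torusBracket_zero_right]
      | add f f' hf hf' =>
        have := congrArg₂ (· + ·) hf hf'
        simp only [torusBracket_add_left, torusBracket_add_right, add_zero] at this ⊢
        rw [← this]; abel
      | single m'' c =>
        simp only [torusBracket_single]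
        rw [show m' + (m'' + m) = m + (m' + m'') by abel,
          show m'' + (m + m') = m + (m' + m'') by abel, ← single_add, ← single_add,
          ← single_zero (m + (m' + m''))]
        congr 1
        simp only [pair, Prod.fst_add, Prod.snd_add]
        push_cast; ring

theorem torusBracket_one_left (g : AddMonoidAlgebra R (ℤ × ℤ)) : torusBracket 1 g = 0 := by
  induction g using induction_linear with
  | zero => exact torusBracket_zero_right _
  | add f f' hf hf' => rw [torusBracket_add_right, hf, hf', add_zero]
  | single m' b => rw [one_def, torusBracket_single]; simp [pair]

theorem torusBracket_one_right (g : AddMonoidAlgebra R (ℤ × ℤ)) : torusBracket g 1 = 0 := by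
  rw [torusBracket_swap, torusBracket_one_left, neg_zero]

/-- The logarithmic derivative of a unit, for the derivation `{f, -}`, is additive. -/
theorem torusBracket_units_zpow (f : AddMonoidAlgebra R (ℤ × ℤ))
    (u : (AddMonoidAlgebra R (ℤ × ℤ))ˣ) (n : ℤ) :
    torusBracket f (u ^ n : (AddMonoidAlgebra R (ℤ × ℤ))ˣ)
      = n • ((u ^ n : (AddMonoidAlgebra R (ℤ × ℤ))ˣ) * (u⁻¹ : (AddMonoidAlgebra R (ℤ × ℤ))ˣ)
        * torusBracket f u) := by
  -- `v ↦ v⁻¹ {f, v}` is a homomorphism from the units to the additive group, so `map_zpow` treats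
  -- positive and negative powers at once.
  let L : (AddMonoidAlgebra R (ℤ × ℤ))ˣ →* Multiplicative (AddMonoidAlgebra R (ℤ × ℤ)) :=
    { toFun := fun v => Multiplicative.ofAdd ((v⁻¹ : (AddMonoidAlgebra R (ℤ × ℤ))ˣ)
        * torusBracket f v)
      map_one' := by rw [Units.val_one, torusBracket_one_right]; simp
      map_mul' := by
        intro v w
        rw [← ofAdd_add, Units.val_mul, torusBracket_mul_right, mul_inv, Units.val_mul]
        congr 1
        have hv : (v : AddMonoidAlgebra R (ℤ × ℤ)) * (v⁻¹ : (AddMonoidAlgebra R (ℤ × ℤ))ˣ) = 1 :=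
          v.mul_inv
        have hw : (w : AddMonoidAlgebra R (ℤ × ℤ)) * (w⁻¹ : (AddMonoidAlgebra R (ℤ × ℤ))ˣ) = 1 :=
          w.mul_inv
        linear_combination ((v⁻¹ : (AddMonoidAlgebra R (ℤ × ℤ))ˣ) * torusBracket f v) * hw
          + ((w⁻¹ : (AddMonoidAlgebra R (ℤ × ℤ))ˣ) * torusBracket f w) * hv }
  have h : Multiplicative.toAdd (L (u ^ n)) = n • Multiplicative.toAdd (L u) := by
    rw [map_zpow, toAdd_zpow]
  have h' : ((u ^ n)⁻¹ : (AddMonoidAlgebra R (ℤ × ℤ))ˣ)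
      * torusBracket f (u ^ n : (AddMonoidAlgebra R (ℤ × ℤ))ˣ)
      = n • ((u⁻¹ : (AddMonoidAlgebra R (ℤ × ℤ))ˣ) * torusBracket f u) := h
  rw [mul_assoc, ← mul_smul_comm, ← h', Units.mul_inv_cancel_left]

end TorusBracket

/-! ### The nilpotent ideal generated by `J` -/

section MonomialIdeal

variable {k P : Type*} [Field k] [AddCommMonoid P]

theorem tmon_mul (I : Set P) (a b : P) (c d : k) :
    tmon I a c * tmon I b d = tmon I (a + b) (c * d) := by
  rw [tmon, tmon, tmon, ← map_mul, single_mul_single]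

theorem tmon_zero_one (I : Set P) : tmon I (0 : P) (1 : k) = 1 := by
  rw [tmon, ← one_def, map_one]

theorem smul_tmon (I : Set P) (a : P) (c d : k) : c • tmon I a d = tmon I a (c * d) := by
  rw [← smul_eq_mul, tmon, tmon, ← smul_single]; rfl

/-- The ideal of `R_I` generated by the monomials with exponent in `J`. -/
def monoIdeal (k : Type*) [Field k] (J I : Set P) : Ideal (RI k I) :=
  Ideal.span ((fun β => tmon I β 1) '' J)

theorem tmon_mem_monoIdeal {J : Set P} (I : Set P) {β : P} (hβ : β ∈ J) (c : k) :
    tmon I β c ∈ monoIdeal k J I := by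
  rw [← mul_one c, ← smul_tmon, Algebra.smul_def]
  exact Ideal.mul_mem_left _ _ (Ideal.subset_span ⟨β, hβ, rfl⟩)

theorem tmon_eq_zero {I : Set P} {β : P} (hβ : β ∈ I) (c : k) : tmon I β c = 0 := by
  rw [← mul_one c, ← smul_tmon]
  have : tmon I β (1 : k) = 0 := Ideal.Quotient.eq_zero_iff_mem.mpr (Ideal.subset_span ⟨β, hβ, rfl⟩)
  rw [this, smul_zero]

theorem tmon_pow (I : Set P) (β : P) (n : ℕ) : tmon I β (1 : k) ^ n = tmon I (n • β) 1 := by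
  rw [tmon, ← map_pow, single_pow, one_pow]; rfl

/-- Each generator is nilpotent because `J` is the radical of `I`. Since `P` is finitely generated,
`R_I` is Noetherian, so the ideal has finitely many generators and is itself nilpotent. -/
theorem monoIdeal_pow_eq_bot [IsToricMonoid P] {J : Set P} (I : IdealWithRadical J) :
    ∃ N, monoIdeal k J I.carrier ^ N = ⊥ := by
  have hfg : AddMonoid.FG P := IsToricMonoid.fg
  have hft : Algebra.FiniteType k (AddMonoidAlgebra k P) :=
    AddMonoidAlgebra.finiteType_iff_fg.mpr hfg
  have hn : IsNoetherianRing (AddMonoidAlgebra k P) := Algebra.FiniteType.isNoetherianRing k _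
  have hn' : IsNoetherianRing (RI k I.carrier) :=
    isNoetherianRing_of_surjective _ _ (RI.mk (k := k) I.carrier) Ideal.Quotient.mk_surjective
  have hle : monoIdeal k J I.carrier ≤ Ideal.radical ⊥ := by
    refine Ideal.span_le.mpr ?_
    rintro _ ⟨β, hβ, rfl⟩
    rw [← I.radical_eq] at hβ
    obtain ⟨n, -, hn⟩ := hβ
    exact ⟨n, by rw [tmon_pow, tmon_eq_zero hn]; exact zero_mem _⟩
  obtain ⟨N, hN⟩ := Ideal.exists_pow_le_of_le_radical_of_fg hle (Ideal.fg_of_isNoetherianRing _)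
  exact ⟨N, le_bot_iff.mp hN⟩

/-- The ideal of the elements of `k[ℤ × P]` all of whose monomials `t^β X^e` have `β ∈ J`. -/
def curveIdeal (k : Type*) [Field k] {J : Set P} (hJ : IsMonoidIdeal J) :
    Ideal (AddMonoidAlgebra k (ℤ × P)) where
  carrier := {f | ∀ s : ℤ × P, s.2 ∉ J → f.coeff s = 0}
  add_mem' hf hg s hs := by rw [coeff_add, Finsupp.add_apply, hf s hs, hg s hs, add_zero]
  zero_mem' s _ := by simp
  smul_mem' c f hf s hs := by
    classical
    rw [smul_eq_mul, coeff_mul]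
    refine Finset.sum_eq_zero fun a _ => Finset.sum_eq_zero fun b _ => ?_
    dsimp only
    split_ifs with h
    · rw [hf b, mul_zero]
      intro hb
      apply hs
      rw [← h, add_comm]
      exact hJ _ hb _
    · rfl

theorem toLaurent_single (I : Set P) (e : ℤ) (β : P) (c : k) :
    toLaurent k I (single (e, β) c) = single e (tmon I β c) := by
  rw [toLaurent, lift_single]
  change c • single e (tmon I β 1) = _
  rw [smul_single, smul_tmon, mul_one]

theorem toLaurent_mem {J : Set P} (hJ : IsMonoidIdeal J) (I : Set P)
    {f : AddMonoidAlgebra k (ℤ × P)} (hf : f ∈ curveIdeal k hJ) :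
    toLaurent k I f ∈ coeffIdeal ℤ (monoIdeal k J I) := by
  rw [← sum_coeff_single f, Finsupp.sum, map_sum]
  refine sum_mem fun s _ => ?_
  by_cases hs : s.2 ∈ J
  · rw [show s = (s.1, s.2) from rfl, toLaurent_single]
    exact single_mem_coeffIdeal (tmon_mem_monoIdeal I hs _) _
  · rw [hf s hs, single_zero, map_zero]
    exact zero_mem _

theorem sub_one_mem_mul {A : Type*} [CommRing A] {K : Ideal A} {f g : A} (hf : f - 1 ∈ K)
    (hg : g - 1 ∈ K) : f * g - 1 ∈ K := by
  have : f * g - 1 = f * (g - 1) + (f - 1) := by ring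
  rw [this]
  exact add_mem (Ideal.mul_mem_left _ _ hg) hf

theorem sub_one_mem_pow {A : Type*} [CommRing A] {K : Ideal A} {f : A} (hf : f - 1 ∈ K) (n : ℕ) :
    f ^ n - 1 ∈ K := by
  induction n with
  | zero => simp
  | succ n ih => rw [pow_succ]; exact sub_one_mem_mul ih hf

/-- The image of `u` in the group of units of the quotient is `1`, hence so are all its powers,
negative ones included. -/
theorem units_zpow_sub_one_mem {A : Type*} [CommRing A] {K : Ideal A} {u : Aˣ}
    (hu : (u : A) - 1 ∈ K) (n : ℤ) : ((u ^ n : Aˣ) : A) - 1 ∈ K := by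
  have h : Units.map (Ideal.Quotient.mk K : A →* A ⧸ K) u = 1 := by
    ext
    simpa [sub_eq_zero] using Ideal.Quotient.eq_zero_iff_mem.mpr hu
  have h' : Units.map (Ideal.Quotient.mk K : A →* A ⧸ K) (u ^ n) = 1 := by
    rw [map_zpow, h, one_zpow]
  have h'' := congrArg Units.val h'
  rw [← Ideal.Quotient.eq_zero_iff_mem, map_sub, map_one, sub_eq_zero]
  exact h''

end MonomialIdeal

/-! ### Wall functions and wall-crossing automorphisms -/

section Walls

variable {r : ℕ} {P k : Type*} [AddCommMonoid P] [Field k] {T : TropData r P} {J : Set P}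
  (D : ScatteringDiagram T J k) (I : IdealWithRadical J)

theorem IdealWithRadical.subset : I.carrier ⊆ J := fun a ha => by
  rw [← I.radical_eq]; exact ⟨1, one_pos, by rwa [one_nsmul]⟩

theorem trunc_coeff {d : Ray r k P} (hd : d ∈ D.rays) {s : ℤ × P} (hs : s.2 ∉ I.carrier) :
    (d.trunc I.carrier).coeff s = d.coeff s := by
  -- Without this finiteness, the `finsum` defining the truncation would take its default value `0`.
  -- It holds because `f_𝔡` lies in the `J`-adic completion.
  have hfin : (Function.support fun s : {s : ℤ × P // s.2 ∉ I.carrier} =>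
      (single s.1 (d.coeff s.1) : AddMonoidAlgebra k (ℤ × P))).Finite := by
    refine ((D.finite_terms d hd I).preimage (f := Subtype.val)
      Subtype.val_injective.injOn).subset ?_
    intro s hs
    refine ⟨s.2, fun h => hs ?_⟩
    simp only [h, single_zero]
  let L : AddMonoidAlgebra k (ℤ × P) →+ k :=
    (Finsupp.applyAddHom s).comp (coeffAddEquiv (R := k) (M := ℤ × P)).toAddMonoidHom
  have hL : ∀ f, L f = f.coeff s := fun _ => rfl
  rw [← hL, Ray.trunc, AddMonoidHom.map_finsum L hfin, finsum_eq_single _ ⟨s, hs⟩]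
  · rw [hL, coeff_single, Finsupp.single_eq_same]
  · intro s' hs'
    rw [hL, coeff_single, Finsupp.single_eq_of_ne]
    rintro rfl
    exact hs' rfl

variable (hJ : IsMonoidIdeal J)
include hJ

theorem trunc_sub_one_mem {d : Ray r k P} (hd : d ∈ D.rays) (hpos : 0 < d.slope) :
    d.trunc I.carrier - 1 ∈ curveIdeal k hJ := by
  rintro ⟨e, β⟩ hβ
  rw [coeff_sub, Finsupp.sub_apply, trunc_coeff D I hd fun h => hβ (I.subset h), one_def,
    coeff_single, sub_eq_zero]
  have htriv := D.trivial_mod d hd (Or.inl hpos)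
  -- `NontrivialMod` only sees exponents `e ≠ 0`. The terms with `e = 0` are controlled by the
  -- normalization of the constant term.
  by_cases he : e = 0
  · subst he
    by_cases hβ0 : β = 0
    · subst hβ0
      rw [d.coeff_zero, ← Prod.zero_eq_mk, Finsupp.single_eq_same]
    · rw [d.coeff_const β hβ0, Finsupp.single_eq_of_ne]
      intro h; exact hβ0 (congrArg Prod.snd h)
  · rw [Finsupp.single_eq_of_ne]
    · by_contra h
      exact htriv ⟨e, β, he, hβ, h⟩
    · intro h; exact he (congrArg Prod.fst h)

theorem wallFn_sub_one_mem (j : ZMod r) {u : ℚ} (hu : 0 < u) :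
    wallFn D I j u - 1 ∈ curveIdeal k hJ := by
  refine finprod_mem_induction (fun f => f - 1 ∈ curveIdeal k hJ) (by simp)
    (fun _ _ => sub_one_mem_mul) ?_
  rintro d ⟨hd, -, -, rfl⟩
  exact trunc_sub_one_mem D I hJ hd hu

theorem wallLaurent_sub_one_mem (j : ZMod r) {u : ℚ} (hu : 0 < u) :
    wallLaurent D I j u - 1 ∈ coeffIdeal ℤ (monoIdeal k J I.carrier) := by
  have := toLaurent_mem hJ I.carrier (wallFn_sub_one_mem D I hJ j hu)
  rwa [map_sub, map_one] at this

/-- The wall function inside a cone is `1` modulo `J`, and so are its powers. Hence a genuine bend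
there raises the `J`-adic order. -/
theorem IsTerm.mem {j : ZMod r} {u : ℚ} {n : ℕ} {e : ℤ} {β : P} {c : k}
    (h : IsTerm D I j u n e β c) (hu : 0 < u) (hne : (e, β) ≠ (0, 0)) : β ∈ J := by
  by_contra hβ
  have := sub_one_mem_pow (wallFn_sub_one_mem D I hJ j hu) n (e, β) hβ
  rw [coeff_sub, Finsupp.sub_apply, h.2.2, one_def, coeff_single,
    Finsupp.single_eq_of_ne (by exact hne), sub_zero] at this
  exact h.2.1 this

omit hJ

/-- The derivation `X d/dX` of `R[X, X⁻¹]`. -/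
def euler {R : Type*} [CommRing R] (F : AddMonoidAlgebra R ℤ) : AddMonoidAlgebra R ℤ :=
  F.coeff.sum fun e c => single e ((e : R) * c)

theorem euler_single {R : Type*} [CommRing R] (e : ℤ) (c : R) :
    euler (single e c) = single e ((e : R) * c) := by
  rw [euler, coeff_single, Finsupp.sum_single_index]; simp

theorem euler_add {R : Type*} [CommRing R] (F G : AddMonoidAlgebra R ℤ) :
    euler (F + G) = euler F + euler G := by
  rw [euler, coeff_add, Finsupp.sum_add_index']
  · rfl
  · simp
  · intro e a b; rw [mul_add, single_add]

/-- Termwise, `{z^{ed}, z^m} = e ⟨d, m⟩ z^{ed+m}`; the factor `e` is what the Euler derivation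
produces. -/
theorem torusBracket_subst_single {I : Set P} (d m : ℤ × ℤ) (F : AddMonoidAlgebra (RI k I) ℤ) :
    torusBracket (subst k I d F) (single m 1)
      = pair d m • (single m 1 * subst k I d (euler F)) := by
  induction F using induction_linear with
  | zero =>
    have : euler (0 : AddMonoidAlgebra (RI k I) ℤ) = 0 := by simp [euler]
    rw [this, map_zero, torusBracket_zero_left]; simp
  | add F G hF hG =>
    rw [map_add, torusBracket_add_left, hF, hG, euler_add, map_add, mul_add, smul_add]
  | single e c =>
    rw [euler_single, subst_single, subst_single, torusBracket_single, single_mul_single,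
      pair_smul_left, smul_single, add_comm m]
    congr 1; rw [zsmul_eq_mul]; push_cast; ring

theorem torusBracket_subst_subst {I : Set P} (d : ℤ × ℤ) (F G : AddMonoidAlgebra (RI k I) ℤ) :
    torusBracket (subst k I d F) (subst k I d G) = 0 := by
  induction F using induction_linear with
  | zero => rw [map_zero, torusBracket_zero_left]
  | add F G hF hG => rw [map_add, torusBracket_add_left, hF, hG, add_zero]
  | single e c =>
    induction G using induction_linear with
    | zero => rw [map_zero, torusBracket_zero_right]
    | add F G hF hG => rw [map_add, torusBracket_add_right, hF, hG, add_zero]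
    | single e' c' =>
      rw [subst_single, subst_single, torusBracket_single, pair_smul_left, pair_smul_right]
      simp [pair, mul_comm]

/-- Both branches of the definition are functions of the single monomial `z^{primGen u}`. This is
all that the Poisson property of the crossing needs. -/
theorem exists_wallUnit_eq (j : ZMod r) (u : ℚ) :
    ∃ F, (wallUnit D I j u : Rsigma k I.carrier) = subst k I.carrier (primGen u) F := by
  unfold wallUnit
  split_ifs with h
  · exact ⟨_, h.unit_spec⟩
  · exact ⟨1, by simp⟩

include hJ in
theorem wallUnit_sub_one_mem (j : ZMod r) {u : ℚ} (hu : 0 < u) :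
    (wallUnit D I j u : Rsigma k I.carrier) - 1
      ∈ coeffIdeal (ℤ × ℤ) (monoIdeal k J I.carrier) := by
  unfold wallUnit
  split_ifs with h
  · rw [h.unit_spec]
    have := algHom_mem_coeffIdeal (wallLaurent_sub_one_mem D I hJ j hu)
      (subst k I.carrier (primGen u))
    rwa [map_sub, map_one] at this
  · simp

theorem wallCross_single (j : ZMod r) (u : ℚ) (m : ℤ × ℤ) (c : RI k I.carrier) :
    wallCross D I j u (single m c) = c • (single m 1
        * ((wallUnit D I j u ^ (-pair (primGen u) m) : (Rsigma k I.carrier)ˣ) :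
            Rsigma k I.carrier)) := by
  rw [wallCross, lift_single]; rfl

/-- On monomials the crossing is `z^m ↦ z^m w^{-⟨d,m⟩}`, with `w` a function of `z^d`. Powers of `w`
commute with each other. The two mixed terms are `⟨d,m⟩⟨d,m'⟩` and its opposite, times the same
element, so they cancel and `⟨m,m'⟩` remains. -/
theorem wallCross_bracket (j : ZMod r) (u : ℚ) (f g : Rsigma k I.carrier) :
    wallCross D I j u (torusBracket f g)
      = torusBracket (wallCross D I j u f) (wallCross D I j u g) := by
  induction f using induction_linear with
  | zero => simp only [map_zero, torusBracket_zero_left]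
  | add f f' hf hf' => simp only [map_add, torusBracket_add_left, hf, hf']
  | single m a =>
    induction g using induction_linear with
    | zero => simp only [map_zero, torusBracket_zero_right]
    | add f f' hf hf' => simp only [map_add, torusBracket_add_right, hf, hf']
    | single m' b =>
      obtain ⟨F, hF⟩ := exists_wallUnit_eq D I j u
      simp only [torusBracket_single, wallCross_single, torusBracket_smul_left,
        torusBracket_smul_right]
      set d := primGen u
      set w := wallUnit D I j u
      -- `E` is the logarithmic Euler derivative of `w`, the factor common to both mixed terms.
      set E := ((w⁻¹ : (Rsigma k I.carrier)ˣ) : Rsigma k I.carrier)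
        * subst k I.carrier d (euler F) with hE
      have h1 : ∀ (m : ℤ × ℤ) (n : ℤ), torusBracket (single m 1)
          ((w ^ n : (Rsigma k I.carrier)ˣ) : Rsigma k I.carrier)
          = -(n * pair d m) • (single m 1
            * ((w ^ n : (Rsigma k I.carrier)ˣ) : Rsigma k I.carrier) * E) := by
        intro m n
        rw [torusBracket_units_zpow, hF, torusBracket_swap, torusBracket_subst_single, hE]
        simp only [zsmul_eq_mul]
        push_cast
        ring
      have h2 : ∀ n n' : ℤ, torusBracket ((w ^ n : (Rsigma k I.carrier)ˣ) : Rsigma k I.carrier)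
          ((w ^ n' : (Rsigma k I.carrier)ˣ) : Rsigma k I.carrier) = 0 := by
        intro n n'
        rw [torusBracket_units_zpow, torusBracket_swap, torusBracket_units_zpow, torusBracket_self]
        simp
      rw [pair_add_right, neg_add, zpow_add, Units.val_mul, torusBracket_mul_left,
        torusBracket_mul_right, torusBracket_mul_right, h1, h2,
        torusBracket_swap ((w ^ (-pair d m) : (Rsigma k I.carrier)ˣ) : Rsigma k I.carrier)
          (single m' 1), h1, torusBracket_single]
      set U := ((w ^ (-pair d m) : (Rsigma k I.carrier)ˣ) : Rsigma k I.carrier)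
      set V := ((w ^ (-pair d m') : (Rsigma k I.carrier)ˣ) : Rsigma k I.carrier)
      have h3 : (single (m + m') (1 : RI k I.carrier) : Rsigma k I.carrier)
          = single m 1 * single m' 1 := by rw [single_mul_single, mul_one]
      have h4 : (single (m + m') (((pair m m' : ℤ) : RI k I.carrier) * (1 * 1)) :
          Rsigma k I.carrier) = pair m m' • (single m 1 * single m' 1) := by
        rw [← h3, smul_single, zsmul_eq_mul, mul_one]
      rw [h3, h4]
      simp only [zsmul_eq_mul]
      simp only [Algebra.smul_def, map_mul, map_intCast]
      push_cast
      ring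

-- A term `c z^m` changes by `c z^m (w^n - 1)`, and the last factor has coefficients in the
-- nilpotent ideal: a crossing is invisible to leading order.
include hJ in
theorem wallCross_sub_mem (j : ZMod r) {u : ℚ} (hu : 0 < u) {𝔞 : Ideal (RI k I.carrier)}
    {f : Rsigma k I.carrier} (hf : f ∈ coeffIdeal (ℤ × ℤ) 𝔞) :
    wallCross D I j u f - f ∈ coeffIdeal (ℤ × ℤ) (𝔞 * monoIdeal k J I.carrier) := by
  refine coeffIdeal_induction hf ((wallCross D I j u).toRingHom.toAddMonoidHom
    - AddMonoidHom.id _) (coeffIdeal (ℤ × ℤ) (𝔞 * monoIdeal k J I.carrier)).toAddSubgroup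
    fun m c hc => ?_
  change wallCross D I j u (single m c) - single m c ∈ coeffIdeal _ _
  rw [wallCross_single]
  have : c • (single m 1 * ((wallUnit D I j u ^ (-pair (primGen u) m) : (Rsigma k I.carrier)ˣ) :
      Rsigma k I.carrier)) - single m c = single m c *
      (((wallUnit D I j u ^ (-pair (primGen u) m) : (Rsigma k I.carrier)ˣ) :
      Rsigma k I.carrier) - 1) := by
    rw [← smul_mul_assoc, smul_single, smul_eq_mul, mul_one]; ring
  rw [this]
  exact mul_mem_coeffIdeal (single_mem_coeffIdeal hc m)
    (units_zpow_sub_one_mem (wallUnit_sub_one_mem D I hJ j hu) _)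

theorem pathAut_induction (j : ZMod r) (S : Set ℝ)
    {C : (Rsigma k I.carrier →ₐ[RI k I.carrier] Rsigma k I.carrier) → Prop}
    (hid : C (AlgHom.id _ _))
    (hcomp : ∀ Φ (u : ℚ), (u : ℝ) ∈ S → C Φ → C ((wallCross D I j u).comp Φ)) :
    C (pathAut D I j S) := by
  classical
  unfold pathAut
  -- The initial automorphism is generalized because `foldl` accumulates in it.
  have : ∀ (l : List ℚ) (Φ : Rsigma k I.carrier →ₐ[RI k I.carrier] Rsigma k I.carrier),
      (∀ u ∈ l, ((u : ℚ) : ℝ) ∈ S) → C Φ →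
      C (l.foldl (fun Φ u => (wallCross D I j u).comp Φ) Φ) := by
    intro l
    induction l with
    | nil => intro Φ _ h; exact h
    | cons u l ih =>
      intro Φ hl h
      exact ih _ (fun v hv => hl v (List.mem_cons_of_mem _ hv)) (hcomp Φ u (hl u (by simp)) h)
  refine this _ _ (fun u hu => ?_) hid
  simp only [Finset.mem_sort, Finset.mem_filter] at hu
  exact hu.2

theorem pathAut_congr (j : ZMod r) {S S' : Set ℝ}
    (h : ∀ u ∈ walls D I j, (u : ℝ) ∈ S ↔ (u : ℝ) ∈ S') : pathAut D I j S = pathAut D I j S' := by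
  classical
  unfold pathAut
  congr 2
  ext u
  simp only [Finset.mem_filter, Set.Finite.mem_toFinset]
  exact and_congr_right (h u)

theorem pathAut_empty (j : ZMod r) : pathAut D I j ∅ = AlgHom.id _ _ := by
  refine pathAut_induction D I j ∅ (C := fun Φ => Φ = AlgHom.id _ _) rfl ?_
  intro Φ u hu
  exact hu.elim

theorem pathAut_bracket (j : ZMod r) (S : Set ℝ) (f g : Rsigma k I.carrier) :
    pathAut D I j S (torusBracket f g)
      = torusBracket (pathAut D I j S f) (pathAut D I j S g) := by
  refine pathAut_induction D I j S
    (C := fun Φ => Φ (torusBracket f g) = torusBracket (Φ f) (Φ g)) rfl ?_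
  intro Φ u _ h
  simp only [AlgHom.comp_apply, h, wallCross_bracket]

include hJ in
theorem pathAut_sub_mem (j : ZMod r) {S : Set ℝ} (hS : S ⊆ Set.Ioi 0)
    {𝔞 : Ideal (RI k I.carrier)} {f : Rsigma k I.carrier} (hf : f ∈ coeffIdeal (ℤ × ℤ) 𝔞) :
    pathAut D I j S f - f ∈ coeffIdeal (ℤ × ℤ) (𝔞 * monoIdeal k J I.carrier) := by
  refine pathAut_induction D I j S
    (C := fun Φ => Φ f - f ∈ coeffIdeal (ℤ × ℤ) (𝔞 * monoIdeal k J I.carrier)) (by simp) ?_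
  intro Φ u hu h
  have hu' : 0 < u := by exact_mod_cast Set.mem_Ioi.mp (hS hu)
  have := add_mem (wallCross_sub_mem D I hJ j hu' (algHom_mem_coeffIdeal hf Φ)) h
  rwa [sub_add_sub_cancel] at this

end Walls

/-! ### The local model at a ray of the fan -/

section LocalModel

variable {r : ℕ} {P k : Type*} [AddCommMonoid P] [Field k] {T : TropData r P} {J : Set P}
  (D : ScatteringDiagram T J k) (I : IdealWithRadical J) (j : ZMod r)

/-- The quotient map onto `R_{ρ,I}`. -/
def rhoMk : MvPolynomial (Fin 2) (AddMonoidAlgebra (RI k I.carrier) ℤ) →ₐ[RI k I.carrier]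
    Rrho D I j :=
  Ideal.Quotient.mkₐ (RI k I.carrier) (Ideal.span {rhoRel D I j})

theorem rhoMk_surjective : Function.Surjective (rhoMk D I j) :=
  Ideal.Quotient.mkₐ_surjective _ _

/-- The element `t^κ f_ρ(X) X^{-D_ρ²}`. -/
def rhoProd : AddMonoidAlgebra (RI k I.carrier) ℤ :=
  single (-T.selfInt j) (tmon I.carrier (T.kink j) 1) * wallLaurent D I j 0

/-- The coordinate `X₊`. -/
def xPlus : Rrho D I j := rhoMk D I j (MvPolynomial.X 0)

/-- The coordinate `X₋`. -/
def xMinus : Rrho D I j := rhoMk D I j (MvPolynomial.X 1)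

/-- The map `R_I[X, X⁻¹] → R_{ρ,I}`. -/
def rhoC (a : AddMonoidAlgebra (RI k I.carrier) ℤ) : Rrho D I j :=
  rhoMk D I j (MvPolynomial.C a)

theorem rhoC_add (a b : AddMonoidAlgebra (RI k I.carrier) ℤ) :
    rhoC D I j (a + b) = rhoC D I j a + rhoC D I j b := by
  simp only [rhoC, map_add]

theorem rhoC_mul (a b : AddMonoidAlgebra (RI k I.carrier) ℤ) :
    rhoC D I j (a * b) = rhoC D I j a * rhoC D I j b := by
  simp only [rhoC, map_mul]

theorem rhoC_smul (c : RI k I.carrier) (a : AddMonoidAlgebra (RI k I.carrier) ℤ) :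
    rhoC D I j (c • a) = c • rhoC D I j a := by
  rw [rhoC, ← MvPolynomial.algebraMap_eq, Algebra.algebraMap_eq_smul_one, smul_assoc, map_smul,
    ← Algebra.algebraMap_eq_smul_one, MvPolynomial.algebraMap_eq, rhoC]

theorem xPlus_mul_xMinus : xPlus D I j * xMinus D I j = rhoC D I j (rhoProd D I j) := by
  rw [xPlus, xMinus, rhoC, ← map_mul, ← sub_eq_zero, ← map_sub]
  exact Ideal.Quotient.eq_zero_iff_mem.mpr (Ideal.subset_span rfl)

theorem psiPlus_rhoC (a : AddMonoidAlgebra (RI k I.carrier) ℤ) :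
    psiPlus D I j (rhoC D I j a) = subst k I.carrier (1, 0) a :=
  evalGens_C k I.carrier _ _ _ a

theorem psiMinus_rhoC (a : AddMonoidAlgebra (RI k I.carrier) ℤ) :
    psiMinus D I j (rhoC D I j a) = subst k I.carrier (0, 1) a :=
  evalGens_C k I.carrier _ _ _ a

theorem psiPlus_xPlus : psiPlus D I j (xPlus D I j) = single (0, 1) 1 :=
  evalGens_X k I.carrier _ _ _ 0

theorem psiMinus_xMinus : psiMinus D I j (xMinus D I j) = single (1, 0) 1 :=
  evalGens_X k I.carrier _ _ _ 1

theorem psiPlus_xMinus : psiPlus D I j (xMinus D I j)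
    = subst k I.carrier (1, 0) (rhoProd D I j) * single (0, -1) 1 := by
  refine (evalGens_X k I.carrier _ _ _ 1).trans ?_
  rw [rhoProd, map_mul, subst_single, mul_comm (single _ _), mul_assoc, single_mul_single]
  simp

theorem psiMinus_xPlus : psiMinus D I j (xPlus D I j)
    = subst k I.carrier (0, 1) (rhoProd D I j) * single (-1, 0) 1 := by
  refine (evalGens_X k I.carrier _ _ _ 0).trans ?_
  rw [rhoProd, map_mul, subst_single, mul_comm (single _ _), mul_assoc, single_mul_single]
  simp

/-- The monomial `X^e X₊^n` if `n ≥ 0`, and `X^e X₋^{-n}` if `n ≤ 0`. -/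
def rhoMon (s : ℤ × ℤ) : Rrho D I j :=
  rhoC D I j (single s.1 1) * (xPlus D I j ^ s.2.toNat * xMinus D I j ^ (-s.2).toNat)

theorem rhoC_mul_mem_span {w : Rrho D I j}
    (hw : w ∈ Submodule.span (RI k I.carrier) (Set.range (rhoMon D I j)))
    (a : AddMonoidAlgebra (RI k I.carrier) ℤ) :
    rhoC D I j a * w ∈ Submodule.span (RI k I.carrier) (Set.range (rhoMon D I j)) := by
  induction a using induction_linear with
  | zero => simp [rhoC]
  | add a b ha hb => rw [rhoC_add, add_mul]; exact add_mem ha hb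
  | single e c =>
    induction hw using Submodule.span_induction with
    | zero => simp
    | add x y _ _ hx hy => rw [mul_add]; exact add_mem hx hy
    | smul b x _ hx => rw [mul_smul_comm]; exact Submodule.smul_mem _ _ hx
    | mem x hx =>
      obtain ⟨s, rfl⟩ := hx
      have : rhoC D I j (single e c) * rhoMon D I j s = c • rhoMon D I j (e + s.1, s.2) := by
        rw [rhoMon, rhoMon, ← mul_assoc, ← rhoC_mul, ← smul_mul_assoc, ← rhoC_smul,
          single_mul_single, smul_single, smul_eq_mul]
      rw [this]
      exact Submodule.smul_mem _ _ (Submodule.subset_span ⟨_, rfl⟩)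

theorem xPlus_mul_mem_span {w : Rrho D I j}
    (hw : w ∈ Submodule.span (RI k I.carrier) (Set.range (rhoMon D I j))) :
    xPlus D I j * w ∈ Submodule.span (RI k I.carrier) (Set.range (rhoMon D I j)) := by
  induction hw using Submodule.span_induction with
  | zero => simp
  | add x y _ _ hx hy => rw [mul_add]; exact add_mem hx hy
  | smul b x _ hx => rw [mul_smul_comm]; exact Submodule.smul_mem _ _ hx
  | mem x hx =>
    obtain ⟨⟨e, n⟩, rfl⟩ := hx
    rcases le_or_gt 0 n with hn | hn
    · refine Submodule.subset_span ⟨(e, n + 1), ?_⟩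
      simp only [rhoMon]
      rw [show (n + 1).toNat = n.toNat + 1 by omega, show (-(n + 1)).toNat = 0 by omega,
        show (-n).toNat = 0 by omega]
      ring
    -- The relation trades one factor `X₊ X₋` for a Laurent polynomial in `X`, which preserves the
    -- span.
    · have : xPlus D I j * rhoMon D I j (e, n)
          = rhoC D I j (rhoProd D I j) * rhoMon D I j (e, n + 1) := by
        rw [← xPlus_mul_xMinus]
        simp only [rhoMon]
        rw [show (n + 1).toNat = 0 by omega, show (-n).toNat = (-(n + 1)).toNat + 1 by omega,
          show n.toNat = 0 by omega]
        ring
      rw [this]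
      exact rhoC_mul_mem_span D I j (Submodule.subset_span ⟨_, rfl⟩) _

theorem xMinus_mul_mem_span {w : Rrho D I j}
    (hw : w ∈ Submodule.span (RI k I.carrier) (Set.range (rhoMon D I j))) :
    xMinus D I j * w ∈ Submodule.span (RI k I.carrier) (Set.range (rhoMon D I j)) := by
  induction hw using Submodule.span_induction with
  | zero => simp
  | add x y _ _ hx hy => rw [mul_add]; exact add_mem hx hy
  | smul b x _ hx => rw [mul_smul_comm]; exact Submodule.smul_mem _ _ hx
  | mem x hx =>
    obtain ⟨⟨e, n⟩, rfl⟩ := hx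
    rcases le_or_gt n 0 with hn | hn
    · refine Submodule.subset_span ⟨(e, n - 1), ?_⟩
      simp only [rhoMon]
      rw [show (-(n - 1)).toNat = (-n).toNat + 1 by omega, show (n - 1).toNat = 0 by omega,
        show n.toNat = 0 by omega]
      ring
    · have : xMinus D I j * rhoMon D I j (e, n)
          = rhoC D I j (rhoProd D I j) * rhoMon D I j (e, n - 1) := by
        rw [← xPlus_mul_xMinus]
        simp only [rhoMon]
        rw [show (-n).toNat = 0 by omega, show n.toNat = (n - 1).toNat + 1 by omega,
          show (-(n - 1)).toNat = 0 by omega]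
        ring
      rw [this]
      exact rhoC_mul_mem_span D I j (Submodule.subset_span ⟨_, rfl⟩) _

theorem mul_mem_span_rhoMon (p : MvPolynomial (Fin 2) (AddMonoidAlgebra (RI k I.carrier) ℤ)) :
    ∀ w ∈ Submodule.span (RI k I.carrier) (Set.range (rhoMon D I j)),
      rhoMk D I j p * w ∈ Submodule.span (RI k I.carrier) (Set.range (rhoMon D I j)) := by
  induction p using MvPolynomial.induction_on with
  | C a => exact fun w hw => rhoC_mul_mem_span D I j hw a
  | add p q hp hq => intro w hw; rw [map_add, add_mul]; exact add_mem (hp w hw) (hq w hw)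
  | mul_X p i hp =>
    intro w hw
    rw [map_mul, mul_assoc]
    fin_cases i
    · exact hp _ (xPlus_mul_mem_span D I j hw)
    · exact hp _ (xMinus_mul_mem_span D I j hw)

theorem rhoMon_zero : rhoMon D I j 0 = 1 := by
  rw [rhoMon, Prod.fst_zero, ← one_def, rhoC, map_one, map_one]; simp

/-- The relation removes all mixed products of `X₊` and `X₋`. The remaining monomials are indexed by
`ℤ²`, the power of `X₋` counting negatively. -/
theorem span_rhoMon : Submodule.span (RI k I.carrier) (Set.range (rhoMon D I j)) = ⊤ := by
  refine eq_top_iff.mpr fun a _ => ?_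
  obtain ⟨p, rfl⟩ := rhoMk_surjective D I j a
  have := mul_mem_span_rhoMon D I j p 1
    (Submodule.subset_span ⟨0, rhoMon_zero D I j⟩)
  rwa [mul_one] at this

theorem Rrho_induction {C : Rrho D I j → Prop} (hX : ∀ e, C (rhoC D I j (single e 1)))
    (hp : C (xPlus D I j)) (hm : C (xMinus D I j)) (zero : C 0)
    (add : ∀ a b, C a → C b → C (a + b)) (mul : ∀ a b, C a → C b → C (a * b))
    (smul : ∀ (c : RI k I.carrier) a, C a → C (c • a)) (a : Rrho D I j) : C a := by
  have one : C 1 := by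
    have := hX 0
    rwa [← one_def, rhoC, map_one, map_one] at this
  have pow : ∀ a, C a → ∀ n : ℕ, C (a ^ n) := by
    intro a ha n
    induction n with
    | zero => rwa [pow_zero]
    | succ n ih => rw [pow_succ]; exact mul _ _ ih ha
  have ha : a ∈ Submodule.span (RI k I.carrier) (Set.range (rhoMon D I j)) := by
    rw [span_rhoMon]; trivial
  induction ha using Submodule.span_induction with
  | zero => exact zero
  | add x y _ _ hx hy => exact add _ _ hx hy
  | smul b x _ hx => exact smul _ _ hx
  | mem x hx =>
    obtain ⟨s, rfl⟩ := hx
    exact mul _ _ (hX _) (mul _ _ (pow _ hp _) (pow _ hm _))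

/-! ### The bracket on the local models -/

/-- `a` and `b` have a bracket in `R_{ρ,I}`, compatible with the brackets on both sides of `ρ`. -/
def HasBracket (a b : Rrho D I j) : Prop :=
  ∃ c : Rrho D I j,
    psiPlus D I j c = torusBracket (psiPlus D I j a) (psiPlus D I j b) ∧
    psiMinus D I j c = torusBracket (psiMinus D I j a) (psiMinus D I j b)

variable {D I j}

theorem HasBracket.symm {a b : Rrho D I j} (h : HasBracket D I j a b) :
    HasBracket D I j b a := by
  obtain ⟨c, h1, h2⟩ := h
  exact ⟨-c, by rw [map_neg, h1, ← torusBracket_swap], by rw [map_neg, h2, ← torusBracket_swap]⟩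

theorem HasBracket.add_right {a b b' : Rrho D I j} (h : HasBracket D I j a b)
    (h' : HasBracket D I j a b') : HasBracket D I j a (b + b') := by
  obtain ⟨c, h1, h2⟩ := h
  obtain ⟨c', h1', h2'⟩ := h'
  exact ⟨c + c', by simp only [map_add, torusBracket_add_right, h1, h1'],
    by simp only [map_add, torusBracket_add_right, h2, h2']⟩

theorem HasBracket.mul_right {a b b' : Rrho D I j} (h : HasBracket D I j a b)
    (h' : HasBracket D I j a b') : HasBracket D I j a (b * b') := by
  obtain ⟨c, h1, h2⟩ := h
  obtain ⟨c', h1', h2'⟩ := h'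
  exact ⟨c * b' + c' * b, by simp only [map_add, map_mul, torusBracket_mul_right, h1, h1'],
    by simp only [map_add, map_mul, torusBracket_mul_right, h2, h2']⟩

theorem HasBracket.smul_right {a b : Rrho D I j} (h : HasBracket D I j a b)
    (c : RI k I.carrier) : HasBracket D I j a (c • b) := by
  obtain ⟨d, h1, h2⟩ := h
  exact ⟨c • d, by simp only [map_smul, torusBracket_smul_right, h1],
    by simp only [map_smul, torusBracket_smul_right, h2]⟩

theorem HasBracket.zero_right (a : Rrho D I j) : HasBracket D I j a 0 :=
  ⟨0, by simp only [map_zero, torusBracket_zero_right],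
    by simp only [map_zero, torusBracket_zero_right]⟩

theorem HasBracket.self (a : Rrho D I j) : HasBracket D I j a a :=
  ⟨0, by rw [map_zero, torusBracket_self], by rw [map_zero, torusBracket_self]⟩

variable (D I j)

theorem hasBracket_rhoC_rhoC (F G : AddMonoidAlgebra (RI k I.carrier) ℤ) :
    HasBracket D I j (rhoC D I j F) (rhoC D I j G) :=
  ⟨0, by rw [map_zero, psiPlus_rhoC, psiPlus_rhoC, torusBracket_subst_subst],
    by rw [map_zero, psiMinus_rhoC, psiMinus_rhoC, torusBracket_subst_subst]⟩

/-- Since `⟨v_j, v_{j+1}⟩ = 1`, the bracket is `(X F'(X)) X₊`. On the side where `X₊` acquires the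
factor `t^κ f_ρ(X) X^{-D_ρ²}`, the same formula holds because functions of `X` Poisson-commute. -/
theorem hasBracket_rhoC_xPlus (F : AddMonoidAlgebra (RI k I.carrier) ℤ) :
    HasBracket D I j (rhoC D I j F) (xPlus D I j) := by
  refine ⟨rhoC D I j (euler F) * xPlus D I j, ?_, ?_⟩
  · rw [map_mul, psiPlus_rhoC, psiPlus_rhoC, psiPlus_xPlus, torusBracket_subst_single]
    simp [pair, mul_comm]
  · rw [map_mul, psiMinus_rhoC, psiMinus_rhoC, psiMinus_xPlus, torusBracket_mul_right,
      torusBracket_subst_subst, torusBracket_subst_single]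
    simp only [pair, zero_mul, mul_neg, mul_one, sub_neg_eq_add, zero_add, one_smul,
      mul_zero]
    ring

theorem hasBracket_rhoC_xMinus (F : AddMonoidAlgebra (RI k I.carrier) ℤ) :
    HasBracket D I j (rhoC D I j F) (xMinus D I j) := by
  refine ⟨-(rhoC D I j (euler F) * xMinus D I j), ?_, ?_⟩
  · rw [map_neg, map_mul, psiPlus_rhoC, psiPlus_rhoC, psiPlus_xMinus, torusBracket_mul_right,
      torusBracket_subst_subst, torusBracket_subst_single]
    simp only [pair, zero_mul, one_mul, sub_zero, zero_add, neg_smul, one_smul, mul_zero]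
    ring
  · rw [map_neg, map_mul, psiMinus_rhoC, psiMinus_rhoC, psiMinus_xMinus,
      torusBracket_subst_single]
    simp [pair, mul_comm]

/-- On each side one of `X₊`, `X₋` is a monomial and the other is its inverse times the function `X₊
X₋` of `X`. Only this function contributes, through its Euler derivative. -/
theorem hasBracket_xPlus_xMinus : HasBracket D I j (xPlus D I j) (xMinus D I j) := by
  refine ⟨-rhoC D I j (euler (rhoProd D I j)), ?_, ?_⟩
  · rw [map_neg, psiPlus_rhoC, psiPlus_xPlus, psiPlus_xMinus, torusBracket_mul_right,
      torusBracket_swap, torusBracket_subst_single, torusBracket_single,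
      show pair (1, 0) (0, 1) = 1 from rfl, show pair (0, 1) (0, -1) = 0 from rfl, one_smul,
      Int.cast_zero, zero_mul, single_zero, zero_mul, add_zero, neg_mul, mul_right_comm,
      single_mul_single, mul_one]
    simp [← Prod.zero_eq_mk, ← one_def]
  · rw [map_neg, psiMinus_rhoC, psiMinus_xPlus, psiMinus_xMinus, torusBracket_mul_left,
      torusBracket_subst_single, torusBracket_single,
      show pair (0, 1) (1, 0) = -1 from rfl, show pair (-1, 0) (1, 0) = 0 from rfl, neg_smul,
      one_smul, Int.cast_zero, zero_mul, single_zero, zero_mul, add_zero, neg_mul,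
      mul_right_comm, single_mul_single, mul_one]
    simp [← Prod.zero_eq_mk, ← one_def]

variable {D I j}

/-- By bilinearity and the Leibniz rule in each variable, it is enough to lift the brackets of the
generators. -/
theorem hasBracket (a b : Rrho D I j) : HasBracket D I j a b := by
  have key : ∀ g, (∀ F, HasBracket D I j g (rhoC D I j F)) → HasBracket D I j g (xPlus D I j) →
      HasBracket D I j g (xMinus D I j) → ∀ b, HasBracket D I j g b :=
    fun g h0 hp hm => Rrho_induction D I j (fun e => h0 _) hp hm (HasBracket.zero_right g)
      (fun _ _ => HasBracket.add_right) (fun _ _ => HasBracket.mul_right)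
      (fun c _ h => h.smul_right c)
  refine Rrho_induction D I j (C := fun a => ∀ b, HasBracket D I j a b) (fun e => ?_) ?_ ?_
    (fun b => (HasBracket.zero_right b).symm) (fun a a' h h' b => ?_) (fun a a' h h' b => ?_)
    (fun c a h b => ((h b).symm.smul_right c).symm) a b
  · exact key _ (fun F => hasBracket_rhoC_rhoC D I j _ F) (hasBracket_rhoC_xPlus D I j _)
      (hasBracket_rhoC_xMinus D I j _)
  · exact key _ (fun F => (hasBracket_rhoC_xPlus D I j F).symm) (HasBracket.self _)
      (hasBracket_xPlus_xMinus D I j)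
  · exact key _ (fun F => (hasBracket_rhoC_xMinus D I j F).symm)
      (hasBracket_xPlus_xMinus D I j).symm (HasBracket.self _)
  · exact ((h b).symm.add_right (h' b).symm).symm
  · exact ((h b).symm.mul_right (h' b).symm).symm

/-! ### Coefficients on the two sides of a ray -/

theorem exists_linearCombination (a : Rrho D I j) :
    ∃ G : ℤ × ℤ →₀ RI k I.carrier,
      a = ∑ s ∈ G.support, G s • rhoMon D I j s := by
  have : a ∈ Submodule.span (RI k I.carrier) (Set.range (rhoMon D I j)) := by
    rw [span_rhoMon]; trivial
  obtain ⟨G, hG⟩ := Finsupp.mem_span_range_iff_exists_finsupp.mp this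
  exact ⟨G, hG.symm⟩

theorem subst_mem_gradeBy {I : Set P} (w : ℤ × ℤ →+ ℤ) {d : ℤ × ℤ} (hd : w d = 0)
    (F : AddMonoidAlgebra (RI k I) ℤ) :
    subst k I d F ∈ gradeBy (RI k I) w 0 := by
  induction F using induction_linear with
  | zero => rw [map_zero]; exact zero_mem _
  | add F G hF hG => rw [map_add]; exact add_mem hF hG
  | single e c =>
    rw [subst_single]
    have := single_mem_gradeBy (R := RI k I) w (e • d) c
    rwa [map_zsmul, hd, smul_zero] at this

theorem coeff_eq_zero_of_mem_gradeBy {R : Type*} [CommRing R] {w : ℤ × ℤ →+ ℤ} {i : ℤ}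
    {f : AddMonoidAlgebra R (ℤ × ℤ)} (hf : f ∈ gradeBy R w i) {m : ℤ × ℤ} (hm : w m ≠ i) :
    f.coeff m = 0 := by
  by_contra h
  exact hm (hf m (Finsupp.mem_support_iff.mpr h))

theorem psiPlus_rhoMon_of_nonneg {s : ℤ × ℤ} (hs : 0 ≤ s.2) :
    psiPlus D I j (rhoMon D I j s) = single s 1 := by
  rw [rhoMon, show (-s.2).toNat = 0 by omega, pow_zero, mul_one, map_mul, map_pow, psiPlus_rhoC,
    psiPlus_xPlus, subst_single, single_pow, single_mul_single]
  congr 1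
  · ext
    · simp
    · simp [hs]
  · simp

theorem psiMinus_rhoMon_of_nonpos {s : ℤ × ℤ} (hs : s.2 ≤ 0) :
    psiMinus D I j (rhoMon D I j s) = single (-s.2, s.1) 1 := by
  rw [rhoMon, show s.2.toNat = 0 by omega, pow_zero, one_mul, map_mul, map_pow, psiMinus_rhoC,
    psiMinus_xMinus, subst_single, single_pow, single_mul_single]
  congr 1
  · ext
    · simp [hs]
    · simp
  · simp

/-- Functions of `X` have degree `0` in the direction transverse to the ray. So distinct powers of
`X₊` and `X₋` have images in distinct degrees and cannot interfere when coefficients are extracted.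
-/
theorem psiPlus_rhoMon_mem_gradeBy (s : ℤ × ℤ) :
    psiPlus D I j (rhoMon D I j s)
      ∈ gradeBy (RI k I.carrier) (AddMonoidHom.snd ℤ ℤ) s.2 := by
  rw [rhoMon, map_mul, map_mul, map_pow, map_pow, psiPlus_rhoC, psiPlus_xPlus, psiPlus_xMinus]
  have h1 : (single (0, 1) 1 : Rsigma k I.carrier) ∈ gradeBy (RI k I.carrier)
      (AddMonoidHom.snd ℤ ℤ) 1 := single_mem_gradeBy (R := RI k I.carrier) _ _ _
  have h2 : (single (0, -1) 1 : Rsigma k I.carrier) ∈ gradeBy (RI k I.carrier)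
      (AddMonoidHom.snd ℤ ℤ) (-1) := single_mem_gradeBy (R := RI k I.carrier) _ _ _
  have h0 := fun F => subst_mem_gradeBy (k := k) (I := I.carrier) (AddMonoidHom.snd ℤ ℤ)
    (d := (1, 0)) rfl F
  have := SetLike.mul_mem_graded (h0 (single s.1 1)) (SetLike.mul_mem_graded
    (SetLike.pow_mem_graded s.2.toNat h1) (SetLike.pow_mem_graded (-s.2).toNat
      (SetLike.mul_mem_graded (h0 (rhoProd D I j)) h2)))
  convert this using 2
  simp only [nsmul_eq_mul]
  omega

theorem psiMinus_rhoMon_mem_gradeBy (s : ℤ × ℤ) :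
    psiMinus D I j (rhoMon D I j s)
      ∈ gradeBy (RI k I.carrier) (AddMonoidHom.fst ℤ ℤ) (-s.2) := by
  rw [rhoMon, map_mul, map_mul, map_pow, map_pow, psiMinus_rhoC, psiMinus_xPlus, psiMinus_xMinus]
  have h1 : (single (1, 0) 1 : Rsigma k I.carrier) ∈ gradeBy (RI k I.carrier)
      (AddMonoidHom.fst ℤ ℤ) 1 := single_mem_gradeBy (R := RI k I.carrier) _ _ _
  have h2 : (single (-1, 0) 1 : Rsigma k I.carrier) ∈ gradeBy (RI k I.carrier)
      (AddMonoidHom.fst ℤ ℤ) (-1) := single_mem_gradeBy (R := RI k I.carrier) _ _ _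
  have h0 := fun F => subst_mem_gradeBy (k := k) (I := I.carrier) (AddMonoidHom.fst ℤ ℤ)
    (d := (0, 1)) rfl F
  have := SetLike.mul_mem_graded (h0 (single s.1 1)) (SetLike.mul_mem_graded
    (SetLike.pow_mem_graded s.2.toNat (SetLike.mul_mem_graded (h0 (rhoProd D I j)) h2))
    (SetLike.pow_mem_graded (-s.2).toNat h1))
  convert this using 2
  simp only [nsmul_eq_mul]
  omega

theorem subst_rhoProd_mem (hκ : T.kink j ∈ J) (d : ℤ × ℤ) :
    subst k I.carrier d (rhoProd D I j) ∈ coeffIdeal (ℤ × ℤ) (monoIdeal k J I.carrier) := by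
  refine algHom_mem_coeffIdeal ?_ _
  exact Ideal.mul_mem_right _ _ (single_mem_coeffIdeal (tmon_mem_monoIdeal _ hκ 1) _)

/-- A positive power of `X₋` maps to a multiple of `t^κ`, and `κ ∈ J`. -/
theorem psiPlus_rhoMon_mem (hκ : T.kink j ∈ J) {s : ℤ × ℤ} (hs : s.2 < 0) :
    psiPlus D I j (rhoMon D I j s) ∈ coeffIdeal (ℤ × ℤ) (monoIdeal k J I.carrier) := by
  rw [rhoMon, map_mul, map_mul, map_pow, map_pow, psiPlus_xMinus]
  refine Ideal.mul_mem_left _ _ (Ideal.mul_mem_left _ _ (Ideal.pow_mem_of_mem _ ?_ _ (by omega)))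
  exact Ideal.mul_mem_right _ _ (subst_rhoProd_mem hκ _)

theorem psiMinus_rhoMon_mem (hκ : T.kink j ∈ J) {s : ℤ × ℤ} (hs : 0 < s.2) :
    psiMinus D I j (rhoMon D I j s) ∈ coeffIdeal (ℤ × ℤ) (monoIdeal k J I.carrier) := by
  rw [rhoMon, map_mul, map_mul, map_pow, map_pow, psiMinus_xPlus]
  refine Ideal.mul_mem_left _ _ (Ideal.mul_mem_right _ _ (Ideal.pow_mem_of_mem _ ?_ _ (by omega)))
  exact Ideal.mul_mem_right _ _ (subst_rhoProd_mem hκ _)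

variable {G : ℤ × ℤ →₀ RI k I.carrier}

theorem psiPlus_coeff_sum (m : ℤ × ℤ) :
    (psiPlus D I j (∑ s ∈ G.support, G s • rhoMon D I j s)).coeff m
      = ∑ s ∈ G.support, G s * (psiPlus D I j (rhoMon D I j s)).coeff m := by
  rw [map_sum, coeff_sum, Finsupp.finsetSum_apply]
  simp only [map_smul, coeff_smul_apply, smul_eq_mul]

theorem psiMinus_coeff_sum (m : ℤ × ℤ) :
    (psiMinus D I j (∑ s ∈ G.support, G s • rhoMon D I j s)).coeff m
      = ∑ s ∈ G.support, G s * (psiMinus D I j (rhoMon D I j s)).coeff m := by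
  rw [map_sum, coeff_sum, Finsupp.finsetSum_apply]
  simp only [map_smul, coeff_smul_apply, smul_eq_mul]

theorem psiPlus_coeff_of_nonneg {m : ℤ × ℤ} (hm : 0 ≤ m.2) :
    (psiPlus D I j (∑ s ∈ G.support, G s • rhoMon D I j s)).coeff m = G m := by
  rw [psiPlus_coeff_sum, Finset.sum_eq_single m]
  · rw [psiPlus_rhoMon_of_nonneg hm, coeff_single, Finsupp.single_eq_same, mul_one]
  · intro s _ hs
    by_cases h : 0 ≤ s.2
    · rw [psiPlus_rhoMon_of_nonneg h, coeff_single, Finsupp.single_eq_of_ne hs.symm, mul_zero]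
    · rw [coeff_eq_zero_of_mem_gradeBy (psiPlus_rhoMon_mem_gradeBy s), mul_zero]
      simp only [AddMonoidHom.coe_snd]; omega
  · intro h
    rw [Finsupp.notMem_support_iff.mp h, zero_mul]

theorem psiMinus_coeff_of_nonneg {m : ℤ × ℤ} (hm : 0 ≤ m.1) :
    (psiMinus D I j (∑ s ∈ G.support, G s • rhoMon D I j s)).coeff m = G (m.2, -m.1) := by
  rw [psiMinus_coeff_sum, Finset.sum_eq_single (m.2, -m.1)]
  · rw [psiMinus_rhoMon_of_nonpos (by simpa using hm), coeff_single]
    simp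
  · intro s _ hs
    by_cases h : s.2 ≤ 0
    · rw [psiMinus_rhoMon_of_nonpos h, coeff_single, Finsupp.single_eq_of_ne, mul_zero]
      rintro rfl
      exact hs (by simp)
    · rw [coeff_eq_zero_of_mem_gradeBy (psiMinus_rhoMon_mem_gradeBy s), mul_zero]
      simp only [AddMonoidHom.coe_fst]; omega
  · intro h
    rw [Finsupp.notMem_support_iff.mp h, zero_mul]

/-- The side of `X₊` reads off exactly the coefficients of the monomials with nonnegative transverse
exponent, and the other side those with nonpositive exponent. Together they determine the element.
-/
theorem psi_injective {a b : Rrho D I j} (hp : psiPlus D I j a = psiPlus D I j b)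
    (hm : psiMinus D I j a = psiMinus D I j b) : a = b := by
  rw [← sub_eq_zero]
  obtain ⟨G, hG⟩ := exists_linearCombination (a - b)
  have hp' : psiPlus D I j (a - b) = 0 := by rw [map_sub, hp, sub_self]
  have hm' : psiMinus D I j (a - b) = 0 := by rw [map_sub, hm, sub_self]
  rw [hG] at hp' hm' ⊢
  refine Finset.sum_eq_zero fun s _ => ?_
  have : G s = 0 := by
    by_cases h : 0 ≤ s.2
    · rw [← psiPlus_coeff_of_nonneg (D := D) (j := j) h, hp']; simp
    · have := psiMinus_coeff_of_nonneg (D := D) (j := j) (G := G) (m := (-s.2, s.1))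
        (by simp only; omega)
      rw [hm'] at this
      simpa using this.symm
  rw [this, zero_smul]

/-- Both coefficients are the coefficient of `X^e`, which is seen unchanged from either side. This
lets values at integral points of `ρ_j` be compared between adjacent cones. -/
theorem psi_coeff_ray (a : Rrho D I j) (e : ℤ) :
    (psiMinus D I j a).coeff (0, e) = (psiPlus D I j a).coeff (e, 0) := by
  obtain ⟨G, rfl⟩ := exists_linearCombination a
  rw [psiPlus_coeff_of_nonneg le_rfl, psiMinus_coeff_of_nonneg le_rfl, neg_zero]

theorem coeff_mem_of_psi_mem {𝔞 : Ideal (RI k I.carrier)}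
    (hp : psiPlus D I j (∑ s ∈ G.support, G s • rhoMon D I j s) ∈ coeffIdeal (ℤ × ℤ) 𝔞)
    (hm : psiMinus D I j (∑ s ∈ G.support, G s • rhoMon D I j s) ∈ coeffIdeal (ℤ × ℤ) 𝔞)
    (s : ℤ × ℤ) : G s ∈ 𝔞 := by
  by_cases h : 0 ≤ s.2
  · rw [← psiPlus_coeff_of_nonneg (D := D) (j := j) h]; exact hp _
  · have := hm (-s.2, s.1)
    rw [psiMinus_coeff_of_nonneg (by simp only; omega)] at this
    simpa using this

/-- Exponents pointing out of the cone across the ray only come from powers of `X₋`, whose image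
carries a factor `t^κ`. This gains one order over the coefficients of the element itself. -/
theorem psiPlus_coeff_mem_of_neg (hκ : T.kink j ∈ J) {𝔞 : Ideal (RI k I.carrier)} {a : Rrho D I j}
    (hp : psiPlus D I j a ∈ coeffIdeal (ℤ × ℤ) 𝔞) (hm : psiMinus D I j a ∈ coeffIdeal (ℤ × ℤ) 𝔞)
    {m : ℤ × ℤ} (h : m.2 < 0) :
    (psiPlus D I j a).coeff m ∈ 𝔞 * monoIdeal k J I.carrier := by
  obtain ⟨G, rfl⟩ := exists_linearCombination a
  rw [psiPlus_coeff_sum]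
  refine Ideal.sum_mem _ fun s _ => ?_
  by_cases hs : s.2 < 0
  · exact Ideal.mul_mem_mul (coeff_mem_of_psi_mem hp hm s) (psiPlus_rhoMon_mem hκ hs m)
  · rw [coeff_eq_zero_of_mem_gradeBy (psiPlus_rhoMon_mem_gradeBy s), mul_zero]
    · exact zero_mem _
    · simp only [AddMonoidHom.coe_snd]; omega

theorem psiMinus_coeff_mem_of_neg (hκ : T.kink j ∈ J) {𝔞 : Ideal (RI k I.carrier)}
    {a : Rrho D I j} (hp : psiPlus D I j a ∈ coeffIdeal (ℤ × ℤ) 𝔞)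
    (hm : psiMinus D I j a ∈ coeffIdeal (ℤ × ℤ) 𝔞) {m : ℤ × ℤ} (h : m.1 < 0) :
    (psiMinus D I j a).coeff m ∈ 𝔞 * monoIdeal k J I.carrier := by
  obtain ⟨G, rfl⟩ := exists_linearCombination a
  rw [psiMinus_coeff_sum]
  refine Ideal.sum_mem _ fun s _ => ?_
  by_cases hs : 0 < s.2
  · exact Ideal.mul_mem_mul (coeff_mem_of_psi_mem hp hm s) (psiMinus_rhoMon_mem hκ hs m)
  · rw [coeff_eq_zero_of_mem_gradeBy (psiMinus_rhoMon_mem_gradeBy s), mul_zero]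
    · exact zero_mem _
    · simp only [AddMonoidHom.coe_fst]; omega

end LocalModel

/-! ### Broken lines -/

section BrokenLines

variable {r : ℕ} {P k : Type*} [AddCommMonoid P] [Field k] {T : TropData r P} {J : Set P}
  {D : ScatteringDiagram T J k} {I : IdealWithRadical J}

theorem IsTerm.mem_walls {j : ZMod r} {u : ℚ} {n : ℕ} {e : ℤ} {β : P} {c : k}
    (h : IsTerm D I j u n e β c) (hne : (e, β) ≠ (0, 0)) : u ∈ walls D I j := by
  by_contra hu
  have h1 : wallFn D I j u = 1 :=
    finprod_mem_eq_one_of_forall_eq_one fun d hd => (hu ⟨d, hd.1, hd.2.1, hd.2.2.1, hd.2.2.2⟩).elim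
  have h2 := h.2.2
  rw [h1, one_pow, one_def, coeff_single, Finsupp.single_eq_of_ne (by exact hne)] at h2
  exact h.2.1 h2.symm

theorem IsTerm.ne_zero {j : ZMod r} {u : ℚ} {n : ℕ} {e : ℤ} {β : P} {c : k}
    (h : IsTerm D I j u n e β c) (hne : (e, β) ≠ (0, 0)) : n ≠ 0 := by
  rintro rfl
  have h2 := h.2.2
  rw [pow_zero, one_def, coeff_single, Finsupp.single_eq_of_ne (by exact hne)] at h2
  exact h.2.1 h2.symm

theorem IsTerm.mem_support {j : ZMod r} {u : ℚ} {n : ℕ} {e : ℤ} {β : P} {c : k}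
    (h : IsTerm D I j u n e β c) : (e, β) ∈ (wallFn D I j u ^ n).coeff.support := by
  rw [Finsupp.mem_support_iff, h.2.2]; exact h.2.1

theorem nsmul_add_mem (hJ : IsMonoidIdeal J) {κ : P} (hκ : κ ∈ J) {n : ℕ} (hn : 0 < n) (β : P) :
    n • κ + β ∈ J := by
  obtain ⟨n, rfl⟩ := Nat.exists_eq_succ_of_ne_zero hn.ne'
  rw [succ_nsmul', add_assoc]
  exact hJ _ hκ _

/-- A bend inside a cone gains an exponent in `J` from the wall function. A crossing of a ray of the
fan gains a positive multiple of its kink, even when the line does not bend. -/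
theorem Step.exists_mem (hJ : IsMonoidIdeal J) (hκ : ∀ j, T.kink j ∈ J) {s s' : Segment r k P}
    (h : Step D I s s') : ∃ β ∈ J, ∃ c, s'.expP = s.expP + β ∧ s'.coeff = s.coeff * c := by
  cases h with
  | bend u e β c hu _ _ hne hterm _ hcoeff hexpP _ _ =>
    exact ⟨β, hterm.mem D I hJ hu hne, c, hexpP, hcoeff⟩
  | crossAnticlockwise e β c _ _ hdir _ _ hcoeff hexpP _ _ =>
    exact ⟨_, nsmul_add_mem hJ (hκ (s.cone + 1)) (n := s.exp.1.toNat) (by omega) β, c, by rw [hexpP, add_assoc], hcoeff⟩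
  | crossClockwise e β c _ _ hdir _ _ hcoeff hexpP _ _ =>
    exact ⟨_, nsmul_add_mem hJ (hκ s.cone) (n := s.exp.2.toNat) (by omega) β, c, by rw [hexpP, add_assoc], hcoeff⟩

theorem chain_tmon_mem (hJ : IsMonoidIdeal J) (hκ : ∀ j, T.kink j ∈ J) (l : List (Segment r k P)) :
    ∀ (s : Segment r k P) (n : ℕ), List.IsChain (Step D I) (s :: l) →
      tmon I.carrier s.expP s.coeff ∈ monoIdeal k J I.carrier ^ n →
      tmon I.carrier ((s :: l).getLast (List.cons_ne_nil _ _)).expP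
        ((s :: l).getLast (List.cons_ne_nil _ _)).coeff
          ∈ monoIdeal k J I.carrier ^ (n + l.length) := by
  induction l with
  | nil => intro s n _ h; exact h
  | cons s' l ih =>
    intro s n hc h
    rw [List.isChain_cons_cons] at hc
    obtain ⟨β, hβ, c, h1, h2⟩ := hc.1.exists_mem hJ hκ
    have := ih s' (n + 1) hc.2 (by
      rw [h1, h2, ← tmon_mul, pow_succ]
      exact Ideal.mul_mem_mul h (tmon_mem_monoIdeal _ hβ c))
    rw [List.getLast_cons_cons, List.length_cons, add_comm l.length, ← add_assoc]
    exact this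

theorem BrokenLine.c_mem (hJ : IsMonoidIdeal J) (hκ : ∀ j, T.kink j ∈ J) {p : BZ r} {Q : Pt r}
    (γ : BrokenLine D I p Q) : γ.c ∈ monoIdeal k J I.carrier ^ γ.tail.length := by
  have := chain_tmon_mem hJ hκ γ.tail γ.first 0 γ.chain (by simp)
  rwa [zero_add] at this

/-! ### Finiteness -/

/-- A segment without its end point. -/
def Segment.label (s : Segment r k P) : ZMod r × k × P × (ℤ × ℤ) :=
  (s.cone, s.coeff, s.expP, s.exp)

omit [AddCommMonoid P] [Field k] in
theorem Segment.eq_of_label {s s' : Segment r k P} (h : s.label = s'.label)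
    (h' : s.endPt = s'.endPt) : s = s' := by
  cases s; cases s'
  simp only [Segment.label, Prod.mk.injEq] at h h'
  obtain ⟨rfl, rfl, rfl, rfl⟩ := h
  subst h'
  rfl

-- A monomial has finitely many successors, because there are finitely many walls and each power of
-- a wall function has finitely many terms.
variable (D I) in
theorem finite_next_labels (ℓ : ZMod r × k × P × (ℤ × ℤ)) :
    {ℓ' | ∃ s s' : Segment r k P, s.label = ℓ ∧ s'.label = ℓ' ∧ Step D I s s'}.Finite := by
  obtain ⟨j, a, b, x⟩ := ℓ
  have hb : (⋃ u ∈ walls D I j,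
      (fun t : ℤ × P => (j, a * (wallFn D I j u ^ (pair (primGen u) x).natAbs).coeff t, b + t.2,
        x + t.1 • primGen u)) ''
        ((wallFn D I j u ^ (pair (primGen u) x).natAbs).coeff.support : Set (ℤ × P))).Finite :=
    (walls_finite D I j).biUnion fun u _ => (Finset.finite_toSet _).image _
  have ha : ((fun t : ℤ × P => (j + 1, a * (wallFn D I (j + 1) 0 ^ x.1.toNat).coeff t,
      b + x.1.toNat • T.kink (j + 1) + t.2, (x.2 - T.selfInt (j + 1) * x.1 + t.1, -x.1))) ''
        ((wallFn D I (j + 1) 0 ^ x.1.toNat).coeff.support : Set (ℤ × P))).Finite :=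
    (Finset.finite_toSet _).image _
  have hc : ((fun t : ℤ × P => (j - 1, a * (wallFn D I j 0 ^ x.2.toNat).coeff t,
      b + x.2.toNat • T.kink j + t.2, (-x.2, x.1 - T.selfInt j * x.2 + t.1))) ''
        ((wallFn D I j 0 ^ x.2.toNat).coeff.support : Set (ℤ × P))).Finite :=
    (Finset.finite_toSet _).image _
  refine ((hb.union ha).union hc).subset ?_
  rintro _ ⟨s, s', hs, rfl, hst⟩
  simp only [Segment.label, Prod.mk.injEq] at hs
  obtain ⟨rfl, rfl, rfl, rfl⟩ := hs
  cases hst with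
  | bend u e β c hu _ _ hne hterm hcone hcoeff hexpP hexp _ =>
    refine Or.inl (Or.inl (Set.mem_biUnion (hterm.mem_walls hne) ⟨(e, β), hterm.mem_support, ?_⟩))
    simp only [Segment.label, hcone, hcoeff, hexpP, hexp, hterm.2.2]
  | crossAnticlockwise e β c _ _ hdir hterm hcone hcoeff hexpP hexp _ =>
    refine Or.inl (Or.inr ⟨(e, β), hterm.mem_support, ?_⟩)
    simp only [Segment.label, hcone, hcoeff, hexpP, hexp, hterm.2.2]
  | crossClockwise e β c _ _ hdir hterm hcone hcoeff hexpP hexp _ =>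
    refine Or.inr ⟨(e, β), hterm.mem_support, ?_⟩
    simp only [Segment.label, eq_sub_of_add_eq hcone, hcoeff, hexpP, hexp, hterm.2.2]

variable (D I) in
/-- The possible labels of the `n`-th segment of a broken line of charge `p`. -/
def labels (p : BZ r) : ℕ → Set (ZMod r × k × P × (ℤ × ℤ))
  | 0 => {ℓ | ℓ.2.1 = 1 ∧ ℓ.2.2.1 = 0 ∧ InCone ℓ.1 ℓ.2.2.2 p}
  | n + 1 => {ℓ' | ∃ s s' : Segment r k P, s.label ∈ labels p n ∧ s'.label = ℓ' ∧ Step D I s s'}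

theorem finite_labels {p : BZ r} (hp : p ≠ none) (n : ℕ) : (labels D I p n).Finite := by
  induction n with
  | zero =>
    obtain ⟨⟨i, a, b⟩, rfl⟩ := Option.ne_none_iff_exists'.mp hp
    refine (Set.toFinite {((i, 1, 0, ((a : ℤ), (b : ℤ))) : ZMod r × k × P × (ℤ × ℤ)),
      (i - 1, 1, 0, (0, (a : ℤ)))}).subset ?_
    rintro ⟨j, c, β, x⟩ ⟨h1, h2, h3⟩
    simp only at h1 h2 h3
    subst h1 h2
    rcases h3 with ⟨rfl, rfl⟩ | ⟨-, rfl, rfl⟩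
    · exact Or.inl rfl
    · exact Or.inr (by simp)
  | succ n ih =>
    refine (ih.biUnion fun ℓ _ => finite_next_labels D I ℓ).subset ?_
    rintro _ ⟨s, s', hs, rfl, hst⟩
    exact Set.mem_biUnion hs ⟨s, s', rfl, rfl, hst⟩

theorem chain_label_mem {p : BZ r} (l : List (Segment r k P)) :
    ∀ (s : Segment r k P) (n : ℕ), List.IsChain (Step D I) (s :: l) → s.label ∈ labels D I p n →
      ∀ s' ∈ s :: l, ∃ i ≤ n + l.length, s'.label ∈ labels D I p i := by
  induction l with
  | nil =>
    intro s n _ h s' hs'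
    rw [List.mem_singleton.mp hs']
    exact ⟨n, by simp, h⟩
  | cons t l ih =>
    intro s n hc h s' hs'
    rw [List.isChain_cons_cons] at hc
    rcases List.mem_cons.mp hs' with rfl | hs'
    · exact ⟨n, by simp, h⟩
    · obtain ⟨i, hi, hi'⟩ := ih t (n + 1) hc.2 ⟨s, t, h, rfl, hc.1⟩ s' hs'
      exact ⟨i, by rw [List.length_cons]; omega, hi'⟩

/-- The points of the line `a x + b y = 0` from which `E` is reached with velocity `-m`, if `m` is
transverse to the line. -/
def sources (a b : ℝ) (m : ℤ × ℤ) (E : ℝ × ℝ) : Set (ℝ × ℝ) :=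
  {x | a * m.1 + b * m.2 ≠ 0 ∧ a * x.1 + b * x.2 = 0 ∧ ∃ t, flow x m t = E}

theorem sources_subsingleton (a b : ℝ) (m : ℤ × ℤ) (E : ℝ × ℝ) :
    (sources a b m E).Subsingleton := by
  rintro x ⟨h, hx, t, rfl⟩ y ⟨-, hy, t', ht⟩
  simp only [flow, Prod.mk.injEq] at ht
  obtain ⟨h1, h2⟩ := ht
  have h3 : (t' - t) * (a * m.1 + b * m.2) = 0 := by
    linear_combination hy - hx - a * h1 - b * h2
  have h4 : t' = t := by
    rcases mul_eq_zero.mp h3 with h3 | h3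
    · linarith
    · exact absurd h3 h
  subst h4
  ext <;> linarith

-- The previous segment ends on one of finitely many lines, transverse to the velocity of the next
-- segment. Its end point is therefore determined by the line and by the end point of the next
-- segment.
variable (D I) in
theorem finite_previous (F : Set (ZMod r × k × P × (ℤ × ℤ))) (hF : F.Finite)
    (s' : Segment r k P) : {s : Segment r k P | s.label ∈ F ∧ Step D I s s'}.Finite := by
  -- The three pieces correspond to the three kinds of step. The swap converts a point of an edge
  -- from the coordinates of the new cone to those of the old one.
  set E : Set (ℝ × ℝ) := (⋃ u ∈ walls D I s'.cone, sources (-(u : ℝ)) 1 s'.exp s'.endPt)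
    ∪ Prod.swap '' sources 0 1 s'.exp s'.endPt ∪ Prod.swap '' sources 1 0 s'.exp s'.endPt with hE
  have hEfin : E.Finite := by
    refine Set.Finite.union (Set.Finite.union ?_ ?_) ?_
    · exact (walls_finite D I s'.cone).biUnion fun u _ => (sources_subsingleton _ _ _ _).finite
    · exact (sources_subsingleton _ _ _ _).finite.image _
    · exact (sources_subsingleton _ _ _ _).finite.image _
  have hinj : Function.Injective fun s : Segment r k P => (s.label, s.endPt) :=
    fun s t h => Segment.eq_of_label (congrArg Prod.fst h) (congrArg Prod.snd h)
  refine ((hF.prod hEfin).preimage hinj.injOn).subset ?_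
  rintro s ⟨hs, hst⟩
  refine ⟨hs, ?_⟩
  change s.endPt ∈ E
  cases hst with
  | bend u e β c hu hpos hon hne hterm hcone hcoeff hexpP hexp hstart =>
    obtain ⟨t, -, ht, -⟩ := hstart
    refine Or.inl (Or.inl (Set.mem_biUnion (hcone ▸ hterm.mem_walls hne) ⟨?_, ?_, t, ht⟩))
    · have h1 := hterm.ne_zero hne
      rw [Int.natAbs_ne_zero] at h1
      -- Bending adds a multiple of the direction of the wall, so the pairing with it is unchanged
      -- and transversality survives.
      have h2 : pair (primGen u) s'.exp = pair (primGen u) s.exp := by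
        rw [hexp, pair_add_right, pair_smul_right]; simp [pair, mul_comm]
      rw [← h2] at h1
      have h3 : ((pair (primGen u) s'.exp : ℤ) : ℝ)
          = u.den * (-(u : ℝ) * s'.exp.1 + 1 * s'.exp.2) := by
        simp only [pair, primGen]
        push_cast
        have : (u : ℝ) * u.den = u.num := by exact_mod_cast Rat.mul_den_eq_num u
        rw [← this]; ring
      intro h4
      rw [h4, mul_zero] at h3
      exact h1 (by exact_mod_cast h3)
    · rw [hon]; ring
  | crossAnticlockwise e β c hpos hon hdir hterm hcone hcoeff hexpP hexp hstart =>
    obtain ⟨t, -, ht, -⟩ := hstart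
    refine Or.inl (Or.inr ⟨(s.endPt.2, 0), ⟨?_, by simp, t, ht⟩, ?_⟩)
    · rw [hexp]
      simp only [zero_mul, one_mul, zero_add, ne_eq, Int.cast_eq_zero]
      omega
    · ext <;> simp [hon]
  | crossClockwise e β c hpos hon hdir hterm hcone hcoeff hexpP hexp hstart =>
    obtain ⟨t, -, ht, -⟩ := hstart
    refine Or.inr ⟨(0, s.endPt.1), ⟨?_, by simp, t, ht⟩, ?_⟩
    · rw [hexp]
      simp only [zero_mul, one_mul, add_zero, ne_eq, Int.cast_eq_zero]
      omega
    · ext <;> simp [hon]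

-- Induction backwards from the fixed final point, adding at the front one of finitely many possible
-- segments.
variable (D I) in
theorem finite_chains (F : Set (ZMod r × k × P × (ℤ × ℤ))) (hF : F.Finite) (x : ℝ × ℝ) (n : ℕ) :
    {l : List (Segment r k P) | l.length = n + 1 ∧ List.IsChain (Step D I) l ∧
      (∀ s ∈ l, s.label ∈ F) ∧ ∀ h, (l.getLast h).endPt = x}.Finite := by
  induction n with
  | zero =>
    have hinj : Function.Injective fun s : Segment r k P => (s.label, s.endPt) :=
      fun s t h => Segment.eq_of_label (congrArg Prod.fst h) (congrArg Prod.snd h)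
    refine (((hF.prod (Set.finite_singleton x)).preimage hinj.injOn).image fun s => [s]).subset ?_
    rintro l ⟨hl, -, hlF, hx⟩
    obtain ⟨s, rfl⟩ := List.length_eq_one_iff.mp hl
    exact ⟨s, ⟨hlF s (by simp), hx (by simp)⟩, rfl⟩
  | succ n ih =>
    have hfin : ∀ l : List (Segment r k P),
        {s : Segment r k P | s.label ∈ F ∧ ∃ s' ∈ l.head?, Step D I s s'}.Finite := by
      intro l
      cases l with
      | nil => simp
      | cons s' l => simpa using finite_previous D I F hF s'
    refine (ih.biUnion fun l _ => (hfin l).image fun s => s :: l).subset ?_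
    rintro l ⟨hl, hc, hlF, hx⟩
    match l, hl with
    | s :: s' :: l, hl =>
      rw [List.isChain_cons_cons] at hc
      refine Set.mem_biUnion (x := s' :: l) ⟨by simpa using hl, hc.2,
        fun t ht => hlF t (List.mem_cons_of_mem _ ht), fun h => ?_⟩
        ⟨s, ⟨hlF s (by simp), s', rfl, hc.1⟩, rfl⟩
      rw [← hx (by simp), List.getLast_cons_cons]

theorem finite_brokenLines [IsToricMonoid P] (hJ : IsMonoidIdeal J) (hκ : ∀ j, T.kink j ∈ J)
    (p : BZ r) (Q : Pt r) : {γ : BrokenLine D I p Q | γ.c ≠ 0}.Finite := by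
  -- There are no broken lines of charge `0`, and the count of initial labels needs a nonzero
  -- charge.
  rcases eq_or_ne p none with rfl | hp
  · refine Set.Finite.subset Set.finite_empty fun γ _ => (γ.charge_ne rfl).elim
  obtain ⟨N, hN⟩ := monoIdeal_pow_eq_bot (k := k) I
  set F := ⋃ i ∈ Set.Iio N, labels D I p i with hFdef
  have hF : F.Finite := (Set.finite_Iio N).biUnion fun i _ => finite_labels hp i
  have hinj : Function.Injective fun γ : BrokenLine D I p Q => γ.first :: γ.tail := by
    intro γ γ' h
    rw [List.cons.injEq] at h
    exact BrokenLine.ext h.1 h.2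
  refine (((Set.finite_Iio N).biUnion fun n _ => finite_chains D I F hF Q.pos n).preimage
    hinj.injOn).subset ?_
  intro γ hγ
  have hlen : γ.tail.length < N := by
    by_contra h
    have := Ideal.pow_le_pow_right (not_lt.mp h) (γ.c_mem hJ hκ)
    rw [hN] at this
    exact hγ this
  refine Set.mem_biUnion (x := γ.tail.length) hlen ⟨by simp, γ.chain, fun s hs => ?_,
    fun _ => γ.last_endPt⟩
  obtain ⟨i, hi, hi'⟩ := chain_label_mem (p := p) γ.tail γ.first 0 γ.chain
    ⟨γ.first_coeff, γ.first_expP, γ.first_exp⟩ s hs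
  exact Set.mem_biUnion (x := i) (show i < N by omega) hi'

/-! ### Straight lines -/

theorem InCone.nonneg {j : ZMod r} {m : ℤ × ℤ} {p : BZ r} (h : InCone j m p) :
    0 ≤ m.1 ∧ 0 ≤ m.2 := by
  match p, h with
  | none, h => obtain rfl : m = 0 := h; exact ⟨le_rfl, le_rfl⟩
  | some (i, a, b), h =>
    rcases h with ⟨-, rfl⟩ | ⟨-, -, rfl⟩ <;> simp

theorem InCone.eq {j : ZMod r} {m : ℤ × ℤ} {p q : BZ r} (h : InCone j m p)
    (h' : InCone j m q) : p = q := by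
  have hpos : ∀ a : ℕ+, (0 : ℤ) < a := fun a => by exact_mod_cast a.pos
  match p, q, h, h' with
  | none, none, _, _ => rfl
  | none, some (i, a, b), h, h' =>
    obtain rfl : m = 0 := h
    have := hpos a
    rcases h' with ⟨-, h'⟩ | ⟨-, -, h'⟩ <;> simp [Prod.ext_iff] at h' <;> omega
  | some (i, a, b), none, h', h =>
    obtain rfl : m = 0 := h
    have := hpos a
    rcases h' with ⟨-, h'⟩ | ⟨-, -, h'⟩ <;> simp [Prod.ext_iff] at h' <;> omega
  | some (i, a, b), some (i', a', b'), h, h' =>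
    have := hpos a
    have := hpos a'
    rcases h with ⟨rfl, rfl⟩ | ⟨rfl, rfl, rfl⟩ <;> rcases h' with ⟨h1, h2⟩ | ⟨h0, h1, h2⟩ <;>
      simp only [Prod.mk.injEq, Nat.cast_inj, PNat.coe_inj] at h2
    · obtain ⟨h2, rfl⟩ := h2
      have : a = a' := by exact_mod_cast h2
      rw [h1, this]
    · omega
    · omega
    · have : a = a' := by exact_mod_cast h2.2
      rw [h0, h1, this]

variable (D I) in
/-- The broken line without bends. -/
def straightLine {p : BZ r} {Q : Pt r} {m : ℤ × ℤ} (hp : p ≠ none) (hQ : Q.pos ∈ openCone)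
    (hm : InCone Q.cone m p) : BrokenLine D I p Q where
  first := ⟨Q.cone, 1, 0, m, Q.pos⟩
  tail := []
  charge_ne := hp
  first_coeff := rfl
  first_expP := rfl
  first_exp := hm
  first_unbounded t ht := by
    obtain ⟨h1, h2⟩ := hm.nonneg
    have h1' : (0 : ℝ) ≤ m.1 := by exact_mod_cast h1
    have h2' : (0 : ℝ) ≤ m.2 := by exact_mod_cast h2
    constructor
    · have := hQ.1
      simp only [flow]
      nlinarith
    · have := hQ.2
      simp only [flow]
      nlinarith
  chain := List.isChain_singleton _
  last_cone := rfl
  last_endPt := rfl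

theorem BrokenLine.inCone_of_tail {p : BZ r} {Q : Pt r} (γ : BrokenLine D I p Q)
    (h : γ.tail = []) : InCone Q.cone γ.s p := by
  obtain ⟨first, tail, h1, h2, h3, h4, h5, h6, h7, h8⟩ := γ
  subst h
  rw [← h7]
  exact h4

theorem BrokenLine.eq_straightLine {p : BZ r} {Q : Pt r} (γ : BrokenLine D I p Q)
    (h : γ.tail = []) {m : ℤ × ℤ} (hs : γ.s = m) (hp : p ≠ none) (hQ : Q.pos ∈ openCone)
    (hm : InCone Q.cone m p) : γ = straightLine D I hp hQ hm := by
  obtain ⟨⟨a, b, c, d, e⟩, tail, h1, h2, h3, h4, h5, h6, h7, h8⟩ := γ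
  subst h
  simp only at h2 h3
  subst h2 h3
  obtain rfl : a = Q.cone := h7
  obtain rfl : e = Q.pos := h8
  obtain rfl : d = m := hs
  rfl

theorem single_coeff_support_finite [IsToricMonoid P] (hJ : IsMonoidIdeal J)
    (hκ : ∀ j, T.kink j ∈ J) (p : BZ r) (Q : Pt r) :
    (Function.support fun γ : BrokenLine D I p Q =>
      (single γ.s γ.c : Rsigma k I.carrier)).Finite := by
  refine (finite_brokenLines hJ hκ p Q).subset fun γ hγ => ?_
  simpa using hγ

/-- Modulo `K` only the line without bends survives. The case `K = ⊥` gives exact coefficients near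
an integral point; the ideal generated by `J` gives the reduction at any point in the interior of a
cone. -/
theorem lift_coeff_sub_mem [IsToricMonoid P] (hJ : IsMonoidIdeal J) (hκ : ∀ j, T.kink j ∈ J)
    {p : BZ r} (hp : p ≠ none) {Q : Pt r} (hQ : Q.pos ∈ openCone) (m : ℤ × ℤ)
    (K : Ideal (RI k I.carrier))
    (hK : ∀ γ : BrokenLine D I p Q, γ.s = m → γ.tail ≠ [] → γ.c ∈ K)
    [Decidable (InCone Q.cone m p)] :
    (lift D I p Q).coeff m - (if InCone Q.cone m p then 1 else 0) ∈ K := by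
  let L : Rsigma k I.carrier →+ RI k I.carrier ⧸ K :=
    (Ideal.Quotient.mk K).toAddMonoidHom.comp ((Finsupp.applyAddHom m).comp
      (coeffAddEquiv (R := RI k I.carrier) (M := ℤ × ℤ)).toAddMonoidHom)
  have hL : ∀ f, L f = Ideal.Quotient.mk K (f.coeff m) := fun _ => rfl
  have hzero : ∀ γ : BrokenLine D I p Q, (γ.tail = [] → γ.s ≠ m) → L (single γ.s γ.c) = 0 := by
    intro γ h
    rw [hL, coeff_single]
    by_cases hs : γ.s = m
    · rw [hs, Finsupp.single_eq_same]
      exact Ideal.Quotient.eq_zero_iff_mem.mpr (hK γ hs fun h' => h h' hs)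
    · rw [Finsupp.single_eq_of_ne (Ne.symm hs), map_zero]
  rw [← Ideal.Quotient.eq_zero_iff_mem, map_sub, ← hL, lift,
    L.map_finsum (single_coeff_support_finite hJ hκ p Q), sub_eq_zero]
  split_ifs with h
  · rw [finsum_eq_single _ (straightLine D I hp hQ h)]
    · rw [hL, coeff_single]
      change Ideal.Quotient.mk K (Finsupp.single m (tmon I.carrier 0 1) m) = _
      rw [Finsupp.single_eq_same, tmon_zero_one]
    · intro γ hγ
      exact hzero γ fun h' hs => hγ (γ.eq_straightLine h' hs hp hQ h)
  · rw [map_zero]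
    refine finsum_eq_zero_of_forall_eq_zero fun γ => hzero γ fun h' hs => h ?_
    rw [← hs]
    exact γ.inCone_of_tail h'

theorem exists_step_getLast (l : List (Segment r k P)) : ∀ s : Segment r k P, l ≠ [] →
    List.IsChain (Step D I) (s :: l) →
      ∃ s', Step D I s' ((s :: l).getLast (List.cons_ne_nil _ _)) := by
  induction l with
  | nil => intro s h; exact (h rfl).elim
  | cons t l ih =>
    intro s _ hc
    rw [List.isChain_cons_cons] at hc
    rw [List.getLast_cons_cons]
    rcases eq_or_ne l [] with rfl | hl
    · exact ⟨s, hc.1⟩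
    · exact ih t hl hc.2

/-- If the line had an earlier segment, the last one would start at `z + t m` with `t > 0`. This
point is interior to the cone, so no ray of the fan has been crossed. It is a positive multiple of a
point of the segment from `p` to `z`, so it lies on no wall either. -/
theorem BrokenLine.tail_eq_nil {p q : BZ r} {z : Pt r} {m : ℤ × ℤ} (h : CloseTo D I p z m)
    (γ : BrokenLine D I q z) (hs : γ.s = m) : γ.tail = [] := by
  by_contra hne
  obtain ⟨s, hst⟩ := exists_step_getLast γ.tail γ.first hne γ.chain
  obtain ⟨⟨⟨hz1, hz2⟩, -⟩, hm, hseg⟩ := h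
  obtain ⟨hm1, hm2⟩ := hm.nonneg
  have hm1' : (0 : ℝ) ≤ m.1 := by exact_mod_cast hm1
  have hm2' : (0 : ℝ) ≤ m.2 := by exact_mod_cast hm2
  have hsrc : ∀ x : ℝ × ℝ, γ.last.StartsAt x →
      ∃ t : ℝ, 0 < t ∧ x.1 = z.pos.1 + t * m.1 ∧ x.2 = z.pos.2 + t * m.2 := by
    rintro x ⟨t, ht, hflow, -⟩
    have hend : γ.last.endPt = z.pos := γ.last_endPt
    have hexp : γ.last.exp = m := hs
    rw [hend, hexp] at hflow
    refine ⟨t, ht, ?_, ?_⟩ <;> rw [← hflow] <;> simp only [flow] <;> ring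
  cases hst with
  | bend u e β c hu hpos hon hne hterm hcone hcoeff hexpP hexp hstart =>
    obtain ⟨t, ht, hx1, hx2⟩ := hsrc _ hstart
    have hw := hterm.mem_walls hne
    have hcone' : s.cone = z.cone := hcone.symm.trans γ.last_cone
    rw [hcone'] at hw
    have ht' : 0 < 1 + t := by linarith
    -- `z + t m` is `1 + t` times the point of parameter `1 / (1 + t)` on the segment from `m` to
    -- `z`, and walls are invariant under scaling.
    refine hseg (1 / (1 + t)) (by positivity) ?_ u hw hu ?_
    · rw [div_le_one ht']; linarith
    · rw [hx1, hx2] at hon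
      field_simp
      linear_combination hon
  | crossAnticlockwise e β c hpos hon hdir hterm hcone hcoeff hexpP hexp hstart =>
    obtain ⟨t, ht, -, hx2⟩ := hsrc _ hstart
    simp only at hx2
    nlinarith
  | crossClockwise e β c hpos hon hdir hterm hcone hcoeff hexpP hexp hstart =>
    obtain ⟨t, ht, hx1, -⟩ := hsrc _ hstart
    simp only at hx1
    nlinarith

theorem lift_coeff_closeTo [IsToricMonoid P] (hJ : IsMonoidIdeal J) (hκ : ∀ j, T.kink j ∈ J)
    {p q : BZ r} (hq : q ≠ none) {z : Pt r} {m : ℤ × ℤ} (h : CloseTo D I p z m)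
    [Decidable (p = q)] :
    (lift D I q z).coeff m = if p = q then 1 else 0 := by
  classical
  have := lift_coeff_sub_mem hJ hκ hq h.1.1 m ⊥
    fun γ hs ht => (ht (γ.tail_eq_nil h hs)).elim
  rw [Ideal.mem_bot, sub_eq_zero] at this
  rw [this]
  refine if_congr ⟨fun h' => h.2.1.eq h', ?_⟩ rfl rfl
  rintro rfl
  exact h.2.1

theorem lift_coeff_mod [IsToricMonoid P] (hJ : IsMonoidIdeal J) (hκ : ∀ j, T.kink j ∈ J)
    {p : BZ r} (hp : p ≠ none) {Q : Pt r} (hQ : Q.pos ∈ openCone) (m : ℤ × ℤ)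
    [Decidable (InCone Q.cone m p)] :
    (lift D I p Q).coeff m - (if InCone Q.cone m p then 1 else 0)
      ∈ monoIdeal k J I.carrier := by
  refine lift_coeff_sub_mem hJ hκ hp hQ m _ fun γ _ ht => ?_
  have := γ.c_mem hJ hκ
  exact Ideal.pow_le_self (by simpa using ht) this

/-- This differs from `ϑ_0 = 1`, but both have zero bracket with everything, which is all that the
structure constants use. -/
theorem lift_none (Q : Pt r) : lift D I none Q = 0 :=
  finsum_eq_zero_of_forall_eq_zero fun γ => (γ.charge_ne rfl).elim

/-! ### Structure constants -/

theorem torusBracket_lift_coeff [IsToricMonoid P] (hJ : IsMonoidIdeal J)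
    (hκ : ∀ j, T.kink j ∈ J) (p₁ p₂ : BZ r) (z : Pt r) (m : ℤ × ℤ) :
    (torusBracket (lift D I p₁ z) (lift D I p₂ z)).coeff m = poissonCoeff D I p₁ p₂ z m := by
  classical
  set S₁ := (finite_brokenLines (D := D) (I := I) hJ hκ p₁ z).toFinset with hS₁
  set S₂ := (finite_brokenLines (D := D) (I := I) hJ hκ p₂ z).toFinset with hS₂
  have hlift : ∀ (p : BZ r) (S : Finset (BrokenLine D I p z)),
      S = (finite_brokenLines (D := D) (I := I) hJ hκ p z).toFinset →
      lift D I p z = ∑ γ ∈ S, single γ.s γ.c := by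
    rintro p S rfl
    refine finsum_eq_sum_of_support_subset _ fun γ hγ => ?_
    simpa using hγ
  rw [hlift p₁ S₁ hS₁, hlift p₂ S₂ hS₂, ← torusBracketₗ_apply, LinearMap.map_sum₂]
  simp_rw [map_sum, torusBracketₗ_apply, torusBracket_single]
  rw [← Finset.sum_product', coeff_sum, Finsupp.finsetSum_apply, poissonCoeff]
  have hsub : (∑ᶠ γ : BrokenPairs D I p₁ p₂ z m, pairTerm γ)
      = ∑ᶠ (γ : BrokenLine D I p₁ z × BrokenLine D I p₂ z) (_ : γ.1.s + γ.2.s = m),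
        ((pair γ.1.s γ.2.s : ℤ) : RI k I.carrier) * (γ.1.c * γ.2.c) :=
    finsum_subtype_eq_finsum_cond (f := fun γ : BrokenLine D I p₁ z × BrokenLine D I p₂ z =>
        ((pair γ.1.s γ.2.s : ℤ) : RI k I.carrier) * (γ.1.c * γ.2.c))
      (p := fun γ => γ.1.s + γ.2.s = m)
  rw [hsub]
  symm
  rw [finsum_eq_sum_of_support_subset (s := S₁ ×ˢ S₂)]
  · refine Finset.sum_congr rfl fun γ _ => ?_
    rw [finsum_eq_if, coeff_single, Finsupp.single_apply]
  · intro γ hγ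
    rw [Function.mem_support, finsum_eq_if] at hγ
    have h1 : γ.1.c ≠ 0 := fun h => hγ (by simp [h])
    have h2 : γ.2.c ≠ 0 := fun h => hγ (by simp [h])
    simp [hS₁, hS₂, h1, h2]

theorem finite_brokenPairs [IsToricMonoid P] (hJ : IsMonoidIdeal J) (hκ : ∀ j, T.kink j ∈ J)
    (p₁ p₂ : BZ r) (z : Pt r) (m : ℤ × ℤ) :
    {γ : BrokenPairs D I p₁ p₂ z m | γ.1.1.c ≠ 0 ∧ γ.1.2.c ≠ 0}.Finite :=
  ((finite_brokenLines hJ hκ p₁ z).prod (finite_brokenLines hJ hκ p₂ z)).preimage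
    Subtype.val_injective.injOn

end BrokenLines

/-! ### Theta functions as global functions -/

section ThetaFunctions

variable {r : ℕ} {P k : Type*} [AddCommMonoid P] [Field k] {T : TropData r P} {J : Set P}
  (D : ScatteringDiagram T J k) (I : IdealWithRadical J)

theorem generic_mk (j : ZMod r) {x : ℝ} (hx : 0 < x) (hirr : Irrational x) :
    (⟨j, (1, x)⟩ : Pt r).Generic :=
  ⟨⟨one_pos, hx⟩, by simpa [Pt.slope] using hirr⟩

theorem slope_mk (j : ZMod r) (x : ℝ) : (⟨j, (1, x)⟩ : Pt r).slope = x := by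
  simp [Pt.slope]

theorem Pt.Generic.slope_pos {Q : Pt r} (hQ : Q.Generic) : 0 < Q.slope :=
  div_pos hQ.1.2 hQ.1.1

theorem exists_pos_le_of_finite {S : Set ℚ} (hS : S.Finite) :
    ∃ δ : ℝ, 0 < δ ∧ ∀ u ∈ S, 0 < u → δ ≤ (u : ℝ) := by
  induction S, hS using Set.Finite.induction_on with
  | empty => exact ⟨1, one_pos, by simp⟩
  | insert _ _ ih =>
    rename_i v S _ _
    obtain ⟨δ, hδ, h⟩ := ih
    by_cases hv : 0 < v
    · refine ⟨min δ v, lt_min hδ (by exact_mod_cast hv), ?_⟩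
      rintro u (rfl | hu) hpos
      · exact min_le_right _ _
      · exact (min_le_left _ _).trans (h u hu hpos)
    · refine ⟨δ, hδ, ?_⟩
      rintro u (rfl | hu) hpos
      · exact absurd hpos hv
      · exact h u hu hpos

theorem exists_slope_small (j : ZMod r) {ε : ℝ} (hε : 0 < ε) :
    ∃ x : ℝ, 0 < x ∧ x < ε ∧ Irrational x ∧ ∀ u ∈ walls D I j, 0 < u → x < (u : ℝ) := by
  obtain ⟨δ, hδ, h⟩ := exists_pos_le_of_finite (walls_finite D I j)
  obtain ⟨x, hirr, h0, hx⟩ := exists_irrational_btwn (lt_min hδ hε)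
  exact ⟨x, h0, hx.trans_le (min_le_right _ _), hirr,
    fun u hu hpos => (hx.trans_le (min_le_left _ _)).trans_le (h u hu hpos)⟩

theorem exists_slope_large (j : ZMod r) (M : ℝ) :
    ∃ x : ℝ, 0 < x ∧ M < x ∧ Irrational x ∧ ∀ u ∈ walls D I j, (u : ℝ) < x := by
  obtain ⟨B, hB⟩ := (walls_finite D I j).bddAbove
  obtain ⟨x, hirr, hx, -⟩ := exists_irrational_btwn (lt_add_one (max (max 0 M) (B : ℝ)))
  have h1 := (le_max_left (max 0 M) (B : ℝ)).trans_lt hx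
  refine ⟨x, (le_max_left _ _).trans_lt h1, (le_max_right _ _).trans_lt h1, hirr, fun u hu => ?_⟩
  have : (u : ℝ) ≤ B := by exact_mod_cast hB hu
  exact (this.trans (le_max_right _ _)).trans_lt hx

variable {D I}

theorem lift_eq_of_nearFirstEdge (hD : ConsistentMod D I) (p : B0Z r) {Q Q' : Pt r}
    (hQ : Q.Generic) (hQ' : Q'.Generic) (hc : Q'.cone = Q.cone) (h : NearFirstEdge D I Q)
    (h' : NearFirstEdge D I Q') : lift D I (some p) Q = lift D I (some p) Q' := by
  -- Consistency only compares a point with one of larger slope, so both points are compared with a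
  -- third one nearer to the edge.
  obtain ⟨x, h0, hx, hirr, -⟩ := exists_slope_small D I Q.cone
    (lt_min hQ.slope_pos hQ'.slope_pos)
  have key : ∀ R : Pt r, R.Generic → R.cone = Q.cone → x < R.slope → NearFirstEdge D I R →
      lift D I (some p) R = lift D I (some p) ⟨Q.cone, (1, x)⟩ := by
    intro R hR hRc hxR hnear
    rw [(hD p).1 ⟨Q.cone, (1, x)⟩ R (generic_mk _ h0 hirr) hR hRc (by rwa [slope_mk]),
      pathAut_congr (S' := ∅), pathAut_empty]
    · rfl
    · intro u hu
      simp only [Set.mem_Ioo, Set.mem_empty_iff_false, iff_false, not_and, not_lt, slope_mk]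
      intro hxu
      refine hnear u (hRc ▸ hu) ?_
      exact_mod_cast h0.trans hxu
  rw [key Q hQ rfl (hx.trans_le (min_le_left _ _)) h,
    key Q' hQ' hc (hx.trans_le (min_le_right _ _)) h']

theorem lift_eq_of_nearSecondEdge (hD : ConsistentMod D I) (p : B0Z r) {Q Q' : Pt r}
    (hQ : Q.Generic) (hQ' : Q'.Generic) (hc : Q'.cone = Q.cone) (h : NearSecondEdge D I Q)
    (h' : NearSecondEdge D I Q') : lift D I (some p) Q = lift D I (some p) Q' := by
  obtain ⟨x, h0, hx, hirr, -⟩ := exists_slope_large D I Q.cone (max Q.slope Q'.slope)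
  have key : ∀ R : Pt r, R.Generic → R.cone = Q.cone → R.slope < x → NearSecondEdge D I R →
      lift D I (some p) ⟨Q.cone, (1, x)⟩ = lift D I (some p) R := by
    intro R hR hRc hxR hnear
    rw [(hD p).1 R ⟨Q.cone, (1, x)⟩ hR (generic_mk _ h0 hirr) hRc.symm (by rwa [slope_mk]),
      pathAut_congr (S' := ∅), pathAut_empty]
    · rfl
    · intro u hu
      simp only [Set.mem_Ioo, Set.mem_empty_iff_false, iff_false, not_and]
      intro hxu
      have := hnear u hu (by exact_mod_cast hR.slope_pos.trans hxu)
      exact absurd hxu (not_lt.mpr this)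
  rw [← key Q hQ rfl ((le_max_left _ _).trans_lt hx) h,
    key Q' hQ' hc ((le_max_right _ _).trans_lt hx) h']

theorem exists_local_theta (hD : ConsistentMod D I) (p : B0Z r) (j : ZMod r) :
    ∃ L : Rrho D I j, ∀ Q : Pt r, Q.Generic →
      (Q.cone = j → NearFirstEdge D I Q → psiPlus D I j L = lift D I (some p) Q) ∧
      (Q.cone + 1 = j → NearSecondEdge D I Q → psiMinus D I j L = lift D I (some p) Q) := by
  obtain ⟨x, hx, -, hxirr, hxw⟩ := exists_slope_small D I j one_pos
  obtain ⟨y, hy, -, hyirr, hyw⟩ := exists_slope_large D I (j - 1) 0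
  have hp : NearFirstEdge D I ⟨j, (1, x)⟩ := fun u hu hpos => by
    rw [slope_mk]; exact (hxw u hu hpos).le
  have hm : NearSecondEdge D I ⟨j - 1, (1, y)⟩ := fun u hu _ => by
    rw [slope_mk]; exact (hyw u hu).le
  obtain ⟨L, h1, h2⟩ := (hD p).2 ⟨j - 1, (1, y)⟩ ⟨j, (1, x)⟩ (generic_mk _ hy hyirr)
    (generic_mk _ hx hxirr) (sub_add_cancel j 1).symm hm hp
  refine ⟨L, fun Q hQ => ⟨fun hc hn => ?_, fun hc hn => ?_⟩⟩
  · exact h1.trans (lift_eq_of_nearFirstEdge hD p (generic_mk _ hx hxirr) hQ hc hp hn)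
  · exact h2.trans (lift_eq_of_nearSecondEdge hD p (generic_mk _ hy hyirr) hQ
      (eq_sub_of_add_eq hc) hm hn)

theorem mem_AI {a : ∀ j : ZMod r, Rrho D I j} :
    a ∈ AI D I ↔ ∀ j, pathAut D I j (Set.Ioi 0) (psiPlus D I j (a j))
      = psiMinus D I (j + 1) (a (j + 1)) := by
  rw [AI, Algebra.mem_iInf]
  rfl

/-- The gluing condition recovers the expression on the other side of each ray from the previous
cone. One side per ray is therefore enough. -/
theorem AI_ext {a b : AI D I} (h : ∀ j, psiPlus D I j (a.1 j) = psiPlus D I j (b.1 j)) :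
    a = b := by
  refine Subtype.ext (funext fun j => psi_injective (h j) ?_)
  obtain ⟨i, rfl⟩ : ∃ i, i + 1 = j := ⟨j - 1, sub_add_cancel j 1⟩
  rw [← mem_AI.mp a.2, ← mem_AI.mp b.2, h]

theorem exists_isTheta (hD : ConsistentMod D I) : ∃ ϑ : BZ r → AI D I, IsTheta D I ϑ := by
  choose L hL using exists_local_theta hD
  have hmem : ∀ p, L p ∈ AI D I := by
    intro p
    refine mem_AI.mpr fun j => ?_
    obtain ⟨x, hx, -, hxirr, hxw⟩ := exists_slope_small D I j one_pos
    obtain ⟨y, hy, hxy, hyirr, hyw⟩ := exists_slope_large D I j x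
    have hp : NearFirstEdge D I ⟨j, (1, x)⟩ := fun u hu hpos => by
      rw [slope_mk]; exact (hxw u hu hpos).le
    have hm : NearSecondEdge D I ⟨j, (1, y)⟩ := fun u hu _ => by
      rw [slope_mk]; exact (hyw u hu).le
    rw [(hL p j _ (generic_mk j hx hxirr)).1 rfl hp,
      (hL p (j + 1) _ (generic_mk j hy hyirr)).2 rfl hm,
      (hD p).1 _ _ (generic_mk j hx hxirr) (generic_mk j hy hyirr) rfl (by simpa [slope_mk])]
    -- The slopes `x < y` enclose all walls in the interior of the cone, so crossing between them is
    -- crossing the whole cone.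
    refine DFunLike.congr_fun (pathAut_congr D I j fun u hu => ?_) _
    simp only [Set.mem_Ioi, Set.mem_Ioo, slope_mk]
    refine ⟨fun h => ⟨hxw u hu (by exact_mod_cast h), hyw u hu⟩, fun h => hx.trans h.1⟩
  refine ⟨fun p => p.elim 1 fun p => ⟨L p, hmem p⟩, rfl, fun p Q hQ => ⟨fun hn => ?_, fun hn => ?_⟩⟩
  · exact (hL p Q.cone Q hQ).1 rfl hn
  · exact (hL p (Q.cone + 1) Q hQ).2 rfl hn

theorem IsTheta.unique {ϑ ϑ' : BZ r → AI D I} (h : IsTheta D I ϑ) (h' : IsTheta D I ϑ') :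
    ϑ = ϑ' := by
  funext p
  match p with
  | none => rw [h.1, h'.1]
  | some p =>
    refine AI_ext fun j => ?_
    obtain ⟨x, hx, -, hxirr, hxw⟩ := exists_slope_small D I j one_pos
    have hp : NearFirstEdge D I ⟨j, (1, x)⟩ := fun u hu hpos => by
      rw [slope_mk]; exact (hxw u hu hpos).le
    exact ((h.2 p _ (generic_mk j hx hxirr)).1 hp).trans
      ((h'.2 p _ (generic_mk j hx hxirr)).1 hp).symm

variable (D I) in
/-- The local expression at a point in the interior of a cone of an element of `A_I`. -/
def localExpr (z : Pt r) : AI D I →ₐ[RI k I.carrier] Rsigma k I.carrier :=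
  ((pathAut D I z.cone (Set.Ioo 0 z.slope)).comp (psiPlus D I z.cone)).comp
    ((Pi.evalAlgHom (RI k I.carrier) (fun j => Rrho D I j) z.cone).comp (AI D I).val)

theorem localExpr_apply (z : Pt r) (a : AI D I) : localExpr D I z a
    = pathAut D I z.cone (Set.Ioo 0 z.slope) (psiPlus D I z.cone (a.1 z.cone)) := rfl

theorem IsTheta.localExpr (hD : ConsistentMod D I) {ϑ : BZ r → AI D I} (h : IsTheta D I ϑ)
    (p : B0Z r) {z : Pt r} (hz : z.Generic) :
    localExpr D I z (ϑ (some p)) = lift D I (some p) z := by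
  obtain ⟨x, hx, hxz, hxirr, hxw⟩ := exists_slope_small D I z.cone hz.slope_pos
  have hp : NearFirstEdge D I ⟨z.cone, (1, x)⟩ := fun u hu hpos => by
    rw [slope_mk]; exact (hxw u hu hpos).le
  have h1 := (h.2 p _ (generic_mk z.cone hx hxirr)).1 hp
  simp only at h1
  rw [localExpr_apply, h1, (hD p).1 _ z (generic_mk z.cone hx hxirr) hz rfl (by rwa [slope_mk])]
  refine DFunLike.congr_fun (pathAut_congr D I z.cone fun u hu => ?_) _
  simp only [Set.mem_Ioo, slope_mk]
  exact and_congr_left fun _ => ⟨fun h => hxw u hu (by exact_mod_cast h), fun h => hx.trans h⟩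

theorem IsGlobalBracket.localExpr
    {br : AI D I →ₗ[RI k I.carrier] AI D I →ₗ[RI k I.carrier] AI D I}
    (h : IsGlobalBracket D I br) (a b : AI D I) (z : Pt r) :
    localExpr D I z (br a b)
      = torusBracket (LPMirror.localExpr D I z a) (LPMirror.localExpr D I z b) := by
  simp only [localExpr_apply, (h a b z.cone).1, pathAut_bracket]

/-! ### The global bracket -/

/-- The lifts in the local models satisfy the gluing condition because the crossing of a whole cone
preserves the bracket. -/
theorem exists_bracket (a b : AI D I) : ∃ c : AI D I, ∀ j,
    psiPlus D I j (c.1 j) = torusBracket (psiPlus D I j (a.1 j)) (psiPlus D I j (b.1 j)) ∧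
    psiMinus D I j (c.1 j) = torusBracket (psiMinus D I j (a.1 j)) (psiMinus D I j (b.1 j)) := by
  choose c hc using fun j => hasBracket (a.1 j) (b.1 j)
  refine ⟨⟨c, mem_AI.mpr fun j => ?_⟩, hc⟩
  rw [(hc j).1, (hc (j + 1)).2, pathAut_bracket, mem_AI.mp a.2, mem_AI.mp b.2]

/-- Elements chosen pair by pair are automatically bilinear, since the expressions in the charts
determine them. -/
theorem exists_isGlobalBracket :
    ∃ br : AI D I →ₗ[RI k I.carrier] AI D I →ₗ[RI k I.carrier] AI D I,
      IsGlobalBracket D I br := by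
  choose c hc using exists_bracket (D := D) (I := I)
  have hplus : ∀ a b j, psiPlus D I j ((c a b).1 j)
    = torusBracket (psiPlus D I j (a.1 j)) (psiPlus D I j (b.1 j)) := fun a b j => (hc a b j).1
  refine ⟨LinearMap.mk₂ _ c (fun a a' b => AI_ext fun j => ?_) (fun x a b => AI_ext fun j => ?_)
    (fun a b b' => AI_ext fun j => ?_) (fun x a b => AI_ext fun j => ?_), hc⟩
  · change _ = psiPlus D I j ((c a b).1 j + (c a' b).1 j)
    rw [map_add, hplus, hplus, hplus, ← torusBracket_add_left, ← map_add]
    rfl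
  · change _ = psiPlus D I j (x • (c a b).1 j)
    rw [map_smul, hplus, hplus, ← torusBracket_smul_left, ← map_smul]
    rfl
  · change _ = psiPlus D I j ((c a b).1 j + (c a b').1 j)
    rw [map_add, hplus, hplus, hplus, ← torusBracket_add_right, ← map_add]
    rfl
  · change _ = psiPlus D I j (x • (c a b).1 j)
    rw [map_smul, hplus, hplus, ← torusBracket_smul_right, ← map_smul]
    rfl

theorem IsGlobalBracket.unique
    {br br' : AI D I →ₗ[RI k I.carrier] AI D I →ₗ[RI k I.carrier] AI D I}
    (h : IsGlobalBracket D I br) (h' : IsGlobalBracket D I br') : br = br' :=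
  LinearMap.ext₂ fun a b => AI_ext fun j => (h a b j).1.trans (h' a b j).1.symm

theorem IsGlobalBracket.isPoissonBracket
    {br : AI D I →ₗ[RI k I.carrier] AI D I →ₗ[RI k I.carrier] AI D I}
    (h : IsGlobalBracket D I br) : IsPoissonBracket br := by
  have hplus : ∀ a b j, psiPlus D I j ((br a b).1 j)
    = torusBracket (psiPlus D I j (a.1 j)) (psiPlus D I j (b.1 j)) := fun a b j => (h a b j).1
  have hmul : ∀ (a b : AI D I) j, psiPlus D I j ((a * b).1 j)
      = psiPlus D I j (a.1 j) * psiPlus D I j (b.1 j) :=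
    fun a b j => map_mul (psiPlus D I j) (a.1 j) (b.1 j)
  have hadd : ∀ (a b : AI D I) j, (a + b).1 j = a.1 j + b.1 j := fun _ _ _ => rfl
  have hneg : ∀ (a : AI D I) j, (-a).1 j = -a.1 j := fun _ _ => rfl
  have hzero : ∀ j, (0 : AI D I).1 j = 0 := fun _ => rfl
  refine ⟨fun a b => AI_ext fun j => ?_, fun a b c => AI_ext fun j => ?_,
    fun a b c => AI_ext fun j => ?_⟩
  · rw [hneg, map_neg, hplus, hplus, ← torusBracket_swap]
  · simp only [hadd, map_add, hmul, hplus, torusBracket_mul_right]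
  · simp only [hadd, map_add, hplus, hzero, map_zero, torusBracket_jacobi]

/-! ### Theta functions generate `A_I` -/

theorem psiMinus_sub_psiPlus_mem (hJ : IsMonoidIdeal J) {𝔞 : Ideal (RI k I.carrier)} (a : AI D I)
    {j : ZMod r} (h : psiPlus D I j (a.1 j) ∈ coeffIdeal (ℤ × ℤ) 𝔞) :
    psiMinus D I (j + 1) (a.1 (j + 1)) - psiPlus D I j (a.1 j)
      ∈ coeffIdeal (ℤ × ℤ) (𝔞 * monoIdeal k J I.carrier) := by
  rw [← mem_AI.mp a.2]
  exact pathAut_sub_mem D I hJ j subset_rfl h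

theorem psiMinus_mem {𝔞 : Ideal (RI k I.carrier)} (a : AI D I)
    (h : ∀ j, psiPlus D I j (a.1 j) ∈ coeffIdeal (ℤ × ℤ) 𝔞) (j : ZMod r) :
    psiMinus D I j (a.1 j) ∈ coeffIdeal (ℤ × ℤ) 𝔞 := by
  obtain ⟨i, rfl⟩ : ∃ i, i + 1 = j := ⟨j - 1, sub_add_cancel j 1⟩
  rw [← mem_AI.mp a.2]
  exact algHom_mem_coeffIdeal (h i) _

/-- The coefficient at the integral point `p` of the local expression of `a ∈ A_I` near `p`. -/
def leadingCoeff (a : AI D I) : BZ r → RI k I.carrier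
  | none => (psiPlus D I 0 (a.1 0)).coeff 0
  | some (i, x, y) => (psiPlus D I i (a.1 i)).coeff ((x : ℤ), (y : ℤ))

theorem leadingCoeff_support_finite [NeZero r] (a : AI D I) :
    (Function.support (leadingCoeff a)).Finite := by
  have hinj : Function.Injective fun p : B0Z r => (p.1, (((p.2.1 : ℕ) : ℤ), ((p.2.2 : ℕ) : ℤ))) := by
    rintro ⟨i, x, y⟩ ⟨i', x', y'⟩ h
    simp only [Prod.mk.injEq, Nat.cast_inj, PNat.coe_inj] at h
    obtain ⟨rfl, rfl, rfl⟩ := h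
    rfl
  have hfin : {p : B0Z r | leadingCoeff a (some p) ≠ 0}.Finite := by
    refine (((Set.finite_univ (α := ZMod r)).biUnion fun i _ =>
      (Set.finite_singleton i).prod
        (Finset.finite_toSet (psiPlus D I i (a.1 i)).coeff.support)).preimage hinj.injOn).subset ?_
    rintro ⟨i, x, y⟩ hp
    exact Set.mem_biUnion (Set.mem_univ i) ⟨rfl, Finsupp.mem_support_iff.mpr hp⟩
  refine ((hfin.image some).union (Set.finite_singleton none)).subset fun p hp => ?_
  match p, hp with
  | none, _ => exact Or.inr rfl
  | some p, hp => exact Or.inl ⟨p, hp, rfl⟩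

theorem leadingCoeff_mem {𝔞 : Ideal (RI k I.carrier)} (a : AI D I)
    (h : ∀ j, psiPlus D I j (a.1 j) ∈ coeffIdeal (ℤ × ℤ) 𝔞) (p : BZ r) :
    leadingCoeff a p ∈ 𝔞 := by
  match p with
  | none => exact h 0 0
  | some (i, x, y) => exact h i _

/-- An integral point on a ray, or the origin, has a coefficient in several cones. These agree
across a ray, and crossing a cone changes them only at the next order, so the choice of cone made in
`leadingCoeff` does not matter. -/
theorem coeff_sub_leadingCoeff_mem [NeZero r] (hJ : IsMonoidIdeal J) {𝔞 : Ideal (RI k I.carrier)}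
    (a : AI D I) (h : ∀ j, psiPlus D I j (a.1 j) ∈ coeffIdeal (ℤ × ℤ) 𝔞) {j : ZMod r} {m : ℤ × ℤ}
    {p : BZ r} (hp : InCone j m p) :
    (psiPlus D I j (a.1 j)).coeff m - leadingCoeff a p ∈ 𝔞 * monoIdeal k J I.carrier := by
  have hstep : ∀ (i : ZMod r) (y : ℤ), (psiPlus D I i (a.1 i)).coeff (0, y)
      - (psiPlus D I (i + 1) (a.1 (i + 1))).coeff (y, 0) ∈ 𝔞 * monoIdeal k J I.carrier := by
    intro i y
    have := psiMinus_sub_psiPlus_mem hJ a (h i) (0, y)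
    rw [coeff_sub, Finsupp.sub_apply, psi_coeff_ray] at this
    rw [← neg_sub]
    exact neg_mem this
  match p, hp with
  | none, hp =>
    obtain rfl : m = 0 := hp
    -- The origin lies in every cone; its coefficients are compared by turning around it from `σ_0`,
    -- one cone at a time.
    have : ∀ n : ℕ, (psiPlus D I (n : ZMod r) (a.1 (n : ZMod r))).coeff 0 - leadingCoeff a none
        ∈ 𝔞 * monoIdeal k J I.carrier := by
      intro n
      induction n with
      | zero => rw [Nat.cast_zero, leadingCoeff, sub_self]; exact zero_mem _
      | succ n ih =>
        have := sub_mem ih (hstep n 0)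
        rw [Nat.cast_succ]
        rwa [← Prod.zero_eq_mk, sub_sub_sub_cancel_left] at this
    have hj := this j.val
    rwa [ZMod.natCast_zmod_val] at hj
  | some (i, x, y), hp =>
    rcases hp with ⟨rfl, rfl⟩ | ⟨rfl, rfl, rfl⟩
    · rw [leadingCoeff, sub_self]; exact zero_mem _
    · exact hstep j x

/-- An exponent outside the quadrant has a negative coordinate. The chart of the first edge treats a
negative second coordinate; that of the second edge treats a negative first one, after crossing the
cone. -/
theorem coeff_mem_of_not_inCone (hJ : IsMonoidIdeal J) (hκ : ∀ j, T.kink j ∈ J)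
    {𝔞 : Ideal (RI k I.carrier)} (a : AI D I)
    (h : ∀ j, psiPlus D I j (a.1 j) ∈ coeffIdeal (ℤ × ℤ) 𝔞) {j : ZMod r} {m : ℤ × ℤ}
    (hm : ∀ p, ¬ InCone j m p) :
    (psiPlus D I j (a.1 j)).coeff m ∈ 𝔞 * monoIdeal k J I.carrier := by
  rcases lt_or_ge m.2 0 with h2 | h2
  · exact psiPlus_coeff_mem_of_neg (hκ j) (h j) (psiMinus_mem a h j) h2
  rcases lt_or_ge m.1 0 with h1 | h1
  · have h3 := psiMinus_sub_psiPlus_mem hJ a (h j) m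
    have h4 := psiMinus_coeff_mem_of_neg (hκ (j + 1)) (h (j + 1)) (psiMinus_mem a h (j + 1)) h1
    have := sub_mem h4 h3
    rwa [coeff_sub, Finsupp.sub_apply, sub_sub_cancel] at this
  exfalso
  obtain ⟨x, y⟩ := m
  simp only at h1 h2
  lift x to ℕ using h1
  lift y to ℕ using h2
  rcases Nat.eq_zero_or_pos x with rfl | hx
  · rcases Nat.eq_zero_or_pos y with rfl | hy
    · exact hm none rfl
    · exact hm (some (j + 1, ⟨y, hy⟩, 0)) (Or.inr ⟨rfl, rfl, rfl⟩)
  · exact hm (some (j, ⟨x, hx⟩, y)) (Or.inl ⟨rfl, rfl⟩)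

open Classical in
theorem IsTheta.coeff_mod [IsToricMonoid P] (hJ : IsMonoidIdeal J) (hκ : ∀ j, T.kink j ∈ J)
    {ϑ : BZ r → AI D I} (h : IsTheta D I ϑ) (p : BZ r) (j : ZMod r) (m : ℤ × ℤ) :
    (psiPlus D I j ((ϑ p).1 j)).coeff m - (if InCone j m p then 1 else 0)
      ∈ monoIdeal k J I.carrier := by
  match p with
  | none =>
    have h1 : (ϑ none).1 j = 1 := by rw [h.1]; rfl
    have h2 : (if InCone j m none then 1 else 0) = (1 : Rsigma k I.carrier).coeff m := by
      rw [one_def, coeff_single, Finsupp.single_apply]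
      exact if_congr ⟨fun h => Eq.symm h, fun h => Eq.symm h⟩ rfl rfl
    rw [h1, map_one, h2, sub_self]
    exact zero_mem _
  | some p =>
    obtain ⟨x, hx, -, hxirr, hxw⟩ := exists_slope_small D I j one_pos
    have hp : NearFirstEdge D I ⟨j, (1, x)⟩ := fun u hu hpos => by
      rw [slope_mk]; exact (hxw u hu hpos).le
    have h1 := (h.2 p _ (generic_mk j hx hxirr)).1 hp
    simp only at h1
    rw [h1]
    exact lift_coeff_mod hJ hκ (Option.some_ne_none p) (generic_mk j hx hxirr).1 m

/-- One step of successive approximation: the combination of theta functions with coefficients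
`leadingCoeff a` matches `a` at all integral points of the cones. All other coefficients, and the
corrections to the theta functions, are of the next order. -/
theorem exists_sub_sum_mem [NeZero r] [IsToricMonoid P] (hJ : IsMonoidIdeal J)
    (hκ : ∀ j, T.kink j ∈ J) {ϑ : BZ r → AI D I} (hϑ : IsTheta D I ϑ)
    {𝔞 : Ideal (RI k I.carrier)} (a : AI D I)
    (h : ∀ j, psiPlus D I j (a.1 j) ∈ coeffIdeal (ℤ × ℤ) 𝔞) :
    ∃ b ∈ Submodule.span (RI k I.carrier) (Set.range ϑ), ∀ j,
      psiPlus D I j ((a - b).1 j) ∈ coeffIdeal (ℤ × ℤ) (𝔞 * monoIdeal k J I.carrier) := by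
  classical
  set S := (leadingCoeff_support_finite a).toFinset with hS
  refine ⟨∑ p ∈ S, leadingCoeff a p • ϑ p,
    sum_mem fun p _ => Submodule.smul_mem _ _ (Submodule.subset_span ⟨p, rfl⟩), fun j m => ?_⟩
  let L : AI D I →ₗ[RI k I.carrier] RI k I.carrier :=
    (Finsupp.lapply m).comp ((coeffLinearEquiv (RI k I.carrier)).toLinearMap.comp
      ((psiPlus D I j).toLinearMap.comp
        ((Pi.evalAlgHom (RI k I.carrier) (fun j => Rrho D I j) j).comp (AI D I).val).toLinearMap))
  have hL : ∀ b : AI D I, L b = (psiPlus D I j (b.1 j)).coeff m := fun _ => rfl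
  rw [← hL, map_sub, map_sum]
  simp only [map_smul, smul_eq_mul]
  have h1 : ∑ p ∈ S, leadingCoeff a p * L (ϑ p)
      - ∑ p ∈ S, leadingCoeff a p * (if InCone j m p then 1 else 0)
        ∈ 𝔞 * monoIdeal k J I.carrier := by
    rw [← Finset.sum_sub_distrib]
    refine Ideal.sum_mem _ fun p _ => ?_
    rw [← mul_sub]
    exact Ideal.mul_mem_mul (leadingCoeff_mem a h p) (hϑ.coeff_mod hJ hκ p j m)
  have h2 : L a - ∑ p ∈ S, leadingCoeff a p * (if InCone j m p then 1 else 0)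
      ∈ 𝔞 * monoIdeal k J I.carrier := by
    by_cases hm : ∃ p, InCone j m p
    · obtain ⟨p, hp⟩ := hm
      rw [Finset.sum_eq_single p]
      · rw [if_pos hp, mul_one]
        exact coeff_sub_leadingCoeff_mem hJ a h hp
      · intro q _ hq
        rw [if_neg fun h => hq (h.eq hp), mul_zero]
      · intro hpS
        have : leadingCoeff a p = 0 := by simpa [hS] using hpS
        rw [this, zero_mul]
    · rw [Finset.sum_eq_zero, sub_zero]
      · exact coeff_mem_of_not_inCone hJ hκ a h fun p hp => hm ⟨p, hp⟩
      · intro p _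
        rw [if_neg fun hp => hm ⟨p, hp⟩, mul_zero]
  have := sub_mem h2 h1
  rwa [sub_sub_sub_cancel_right] at this

theorem IsTheta.mem_span [NeZero r] [IsToricMonoid P] (hJ : IsMonoidIdeal J)
    (hκ : ∀ j, T.kink j ∈ J) {ϑ : BZ r → AI D I} (hϑ : IsTheta D I ϑ) (a : AI D I) :
    a ∈ Submodule.span (RI k I.carrier) (Set.range ϑ) := by
  obtain ⟨N, hN⟩ := monoIdeal_pow_eq_bot (k := k) I
  -- Induction on the number `d` of powers left before the ideal vanishes.
  have key : ∀ d n, n + d = N → ∀ a : AI D I,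
      (∀ j, psiPlus D I j (a.1 j) ∈ coeffIdeal (ℤ × ℤ) (monoIdeal k J I.carrier ^ n)) →
      a ∈ Submodule.span (RI k I.carrier) (Set.range ϑ) := by
    intro d
    induction d with
    | zero =>
      rintro n rfl a ha
      have : a = 0 := AI_ext fun j => by
        have := ha j
        rw [add_zero] at hN
        rw [hN] at this
        rw [coeffIdeal_bot this]
        exact (map_zero (psiPlus D I j)).symm
      rw [this]
      exact zero_mem _
    | succ d ih =>
      intro n hn a ha
      obtain ⟨b, hb, hab⟩ := exists_sub_sum_mem hJ hκ hϑ a ha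
      have := add_mem (ih (n + 1) (by omega) (a - b) fun j => by rw [pow_succ]; exact hab j) hb
      rwa [sub_add_cancel] at this
  refine key N 0 (zero_add N) a fun j => ?_
  rw [pow_zero, Ideal.one_eq_top]
  exact fun _ => trivial

-- Extracting the coefficient of `z^p` close to `p` is dual to the theta functions, the constant
-- function `ϑ_0` included.
open Classical in
theorem IsTheta.localExpr_coeff [IsToricMonoid P] (hJ : IsMonoidIdeal J)
    (hκ : ∀ j, T.kink j ∈ J) (hD : ConsistentMod D I) {ϑ : BZ r → AI D I} (h : IsTheta D I ϑ)
    {p q : BZ r} {z : Pt r} {m : ℤ × ℤ} (hz : CloseTo D I p z m) :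
    (LPMirror.localExpr D I z (ϑ q)).coeff m = if p = q then 1 else 0 := by
  match q with
  | none =>
    rw [h.1, map_one, one_def, coeff_single, Finsupp.single_apply]
    refine if_congr ⟨fun h0 => ?_, ?_⟩ rfl rfl
    · exact hz.2.1.eq (show InCone z.cone m none from h0.symm)
    · rintro rfl
      exact Eq.symm hz.2.1
  | some q => rw [h.localExpr hD q hz.1, lift_coeff_closeTo hJ hκ (Option.some_ne_none q) hz]

theorem localExpr_bracket_coeff [IsToricMonoid P] (hJ : IsMonoidIdeal J)
    (hκ : ∀ j, T.kink j ∈ J) (hD : ConsistentMod D I) {ϑ : BZ r → AI D I} (hϑ : IsTheta D I ϑ)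
    {br : AI D I →ₗ[RI k I.carrier] AI D I →ₗ[RI k I.carrier] AI D I}
    (hbr : IsGlobalBracket D I br) (p₁ p₂ : BZ r) {z : Pt r} (hz : z.Generic) (m : ℤ × ℤ) :
    (localExpr D I z (br (ϑ p₁) (ϑ p₂))).coeff m = poissonCoeff D I p₁ p₂ z m := by
  rw [← torusBracket_lift_coeff hJ hκ, hbr.localExpr]
  match p₁, p₂ with
  | none, p₂ => rw [hϑ.1, map_one, torusBracket_one_left, lift_none, torusBracket_zero_left]
  | some p₁, none =>
    rw [hϑ.1, map_one, torusBracket_one_right, lift_none, torusBracket_zero_right]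
  | some p₁, some p₂ => rw [hϑ.localExpr hD p₁ hz, hϑ.localExpr hD p₂ hz]

/-- Spanning provides some coefficients, and duality identifies each of them with the sum over pairs
of broken lines. This also gives the independence of the sums from the chosen points close to `p`.
-/
theorem exists_structure_constants [NeZero r] [IsToricMonoid P] (hJ : IsMonoidIdeal J)
    (hκ : ∀ j, T.kink j ∈ J) (hD : ConsistentMod D I) {ϑ : BZ r → AI D I} (hϑ : IsTheta D I ϑ)
    {br : AI D I →ₗ[RI k I.carrier] AI D I →ₗ[RI k I.carrier] AI D I}
    (hbr : IsGlobalBracket D I br) (p₁ p₂ : BZ r) :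
    ∃ c : BZ r →₀ RI k I.carrier, (c.sum fun p x => x • ϑ p) = br (ϑ p₁) (ϑ p₂) ∧
      ∀ p z m, CloseTo D I p z m → poissonCoeff D I p₁ p₂ z m = c p := by
  classical
  obtain ⟨c, hc⟩ := Finsupp.mem_span_range_iff_exists_finsupp.mp
    (hϑ.mem_span hJ hκ (br (ϑ p₁) (ϑ p₂)))
  refine ⟨c, hc, fun p z m hz => ?_⟩
  rw [← localExpr_bracket_coeff hJ hκ hD hϑ hbr p₁ p₂ hz.1, ← hc, Finsupp.sum, map_sum, coeff_sum,
    Finsupp.finsetSum_apply]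
  simp only [map_smul, coeff_smul_apply, hϑ.localExpr_coeff hJ hκ hD hz, smul_eq_mul, mul_ite,
    mul_one, mul_zero]
  rw [Finset.sum_ite_eq, ite_eq_left_iff]
  intro h
  exact (Finsupp.notMem_support_iff.mp h).symm

end ThetaFunctions

end LPMirror

end

open LPMirror

theorem mainTheorem7 {r : ℕ} (hr : 3 ≤ r) {P k : Type*} [AddCommMonoid P] [IsToricMonoid P]
    [Field k] [CharZero k] (T : TropData r P) (J : Set P) (hJ : IsMonoidIdeal J)
    (hJrad : monoidRadical J = J) (hκ : ∀ j, T.kink j ∈ J)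
    (D : ScatteringDiagram T J k) (hD : Consistent D) (I : IdealWithRadical J) :
    -- the theta functions are well defined
    (∃! ϑ : BZ r → AI D I, IsTheta D I ϑ) ∧
    -- the Poisson bracket of the charts extends to a unique bracket, and it is Poisson
    (∃! br : AI D I →ₗ[RI k I.carrier] AI D I →ₗ[RI k I.carrier] AI D I,
      IsGlobalBracket D I br) ∧
    ∀ (ϑ : BZ r → AI D I) (br : AI D I →ₗ[RI k I.carrier] AI D I →ₗ[RI k I.carrier] AI D I),
      IsTheta D I ϑ → IsGlobalBracket D I br →
      IsPoissonBracket br ∧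
      ∀ (p₁ p₂ : BZ r) (z : BZ r → Pt r) (m : BZ r → ℤ × ℤ), (∀ p, CloseTo D I p (z p) (m p)) →
        -- all the sums are finite
        (∀ p, {γ : BrokenPairs D I p₁ p₂ (z p) (m p) | γ.1.1.c ≠ 0 ∧ γ.1.2.c ≠ 0}.Finite) ∧
        {p | poissonCoeff D I p₁ p₂ (z p) (m p) ≠ 0}.Finite ∧
        br (ϑ p₁) (ϑ p₂) = ∑ᶠ p : BZ r, poissonCoeff D I p₁ p₂ (z p) (m p) • ϑ p := by
  have : NeZero r := ⟨by omega⟩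
  obtain ⟨ϑ₀, hϑ₀⟩ := exists_isTheta (hD I)
  obtain ⟨br₀, hbr₀⟩ := exists_isGlobalBracket (D := D) (I := I)
  refine ⟨⟨ϑ₀, hϑ₀, fun ϑ hϑ => hϑ.unique hϑ₀⟩, ⟨br₀, hbr₀, fun br hbr => hbr.unique hbr₀⟩,
    fun ϑ br hϑ hbr => ⟨hbr.isPoissonBracket, fun p₁ p₂ z m hz =>
      ⟨fun p => finite_brokenPairs hJ hκ p₁ p₂ (z p) (m p), ?_⟩⟩⟩
  obtain ⟨c, hc, hcp⟩ := exists_structure_constants hJ hκ (hD I) hϑ hbr p₁ p₂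
  have hP : ∀ p, poissonCoeff D I p₁ p₂ (z p) (m p) = c p := fun p => hcp p _ _ (hz p)
  simp only [hP]
  -- The structure constants are the values of a finitely supported function, which justifies the
  -- sum over all of `B(ℤ)`.
  refine ⟨c.hasFiniteSupport, ?_⟩
  rw [← hc, Finsupp.sum, finsum_eq_sum_of_support_subset]
  intro p hp
  rw [Finset.mem_coe, Finsupp.mem_support_iff]
  rintro h
  rw [Function.mem_support, h, zero_smul] at hp
  exact hp rfl
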